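/- There are one target task ($k=0$, sample size $n_T$) and $K\ge 1$ source tasks ($k=1,\dots,K$, sample size $n_S$ each); put $n_0=n_T$, $n_k=n_S$ for $k\ge1$, and $N=Kn_S+n_T$. The observations follow the linear models $y^{(k)}_i=\langle X^{(k)}_i,\beta^{(k)}\rangle+\epsilon^{(k)}_i$ in $\mathbb R^p$, $1\le i\le n_k$. Designs: within each task the rows $X^{(k)}_i$ are independent, have mean zero and covariance matrix $\Sigma^{(k)}$, and are sub-Gaussian with variance proxy $\kappa$, i.e. $\mathbb E e^{t\langle X^{(k)}_i,u\rangle}\le e^{\kappa t^2/2}$ for all $t\in\mathbb R$ and all unit vectors $u$; all eigenvalues of all $\Sigma^{(k)}$ lie in $[1/c_\Sigma,c_\Sigma]$. The covariances may differ across tasks. Errors: all the $\epsilon^{(k)}_i$, $0\le k\le K$, $1\le i\le n_k$, are jointly independent centred Gaussian variables with variances at most $V$, independent of all the designs. Parameters: $\|\beta^{(0)}\|_0\le s$ with $s\ge1$, and $\|\beta^{(k)}-\beta^{(0)}\|_1\le h_k$ for $1\le k\le K$. Put $\bar h=\frac{n_S}{N}\sum_{k=1}^K h_k$, $v_n=\sqrt{K^2\log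 p/n_S}\,\bar h$, $w=\frac{n_S}{N}\sum_{k=1}^K\beta^{(k)}+\frac{n_T}{N}\beta^{(0)}$, and let $\varepsilon_D$ be any number with $\big\|\frac{n_S}{N}\sum_{k=1}^K(\beta^{(k)}-\beta^{(0)})\big\|_1\le\varepsilon_D$. Estimator: $\hat\beta=(\hat\beta^{(0)},\dots,\hat\beta^{(K)})$ is a minimizer over $\mathbb R^{(K+1)p}$ of $$\frac1{2N}\sum_{k=0}^K\sum_{i=1}^{n_k}\big(y^{(k)}_i-\langle X^{(k)}_i,b^{(k)}\rangle\big)^2+\lambda_0\Big(\|b^{(0)}\|_1+\sum_{k=1}^K a_k\|b^{(k)}-b^{(0)}\|_1\Big),$$ and $\hat w=\frac{n_S}{N}\sum_{k=1}^K\hat\beta^{(k)}+\frac{n_T}{N}\hat\beta^{(0)}$. Theorem. For all $c_\Sigma>0$, $\kappa,V\ge0$ and $A\in\mathbb R$ there are constants $c_0,M,C,c_1,c_2,c_3,c_4>0$, depending only on $c_\Sigma,\kappa,V,A$, such that the following holds for all $K\ge1$, $n_T$, $n_S$, $p$, $s\ge1$, $h$, $\beta$ and all designs and errors as above with $\log K\le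 A\log p$ and $n_S\ge M s\log p$. Take $\lambda_0=c_0\sqrt{\log p/N}$ and $a_k=8\sqrt{n_S/N}$. Then, with probability at least $1-c_1\exp(-c_2n_T)-c_3\exp(-c_4\log p)$, a minimizer $\hat\beta$ exists and every minimizer satisfies both $$\|\hat w-w\|_2^2\le C\Big(\frac{s\log p}{N}+(1+v_n)\bar h\sqrt{\frac{\log p}{n_S}}\Big)$$ and $$\|\hat w-\beta^{(0)}\|_2^2\le C\Big(\frac{s\log p}{N}+(1+v_n)\bar h\sqrt{\frac{\log p}{n_S}}+\varepsilon_D^2\Big).$$ -/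

import Mathlib

open MeasureTheory ProbabilityTheory
open scoped NNReal

universe u

namespace TransFusion

noncomputable section

/-- The sample size of task `k`: task `0` is the target task (`nT` observations), the tasks
`1, …, K` are the source tasks (`nS` observations each). -/
def sampleSize {K : ℕ} (nT nS : ℕ) (k : Fin (K + 1)) : ℕ := if k = 0 then nT else nS

/-- Total sample size `N = K nS + nT`. -/
def totalSize (K nT nS : ℕ) : ℕ := K * nS + nT

/-- The `ℓ₁`-norm of a vector. -/
def l1Norm {p : ℕ} (v : EuclideanSpace ℝ (Fin p)) : ℝ := ∑ j, |v j|

/-- The number of nonzero entries of a vector. -/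
def l0Norm {p : ℕ} (v : EuclideanSpace ℝ (Fin p)) : ℕ := {j : Fin p | v j ≠ 0}.ncard

/-- The parameter space `Θ(s, h)`: the target parameter `β 0` has at most `s` nonzero entries and
the contrast of each source parameter has `ℓ₁`-norm at most `h k`. Source tasks are indexed by
`k : Fin K`, source `k` being task `k.succ`. -/
def paramSpace {K p : ℕ} (s : ℕ) (h : Fin K → ℝ) :
    Set (Fin (K + 1) → EuclideanSpace ℝ (Fin p)) :=
  {β | l0Norm (β 0) ≤ s ∧ ∀ k : Fin K, l1Norm (β k.succ - β 0) ≤ h k}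

/-- The covariance matrix of a random vector. -/
def covMatrix {Ω : Type u} [MeasurableSpace Ω] (μ : Measure Ω) {p : ℕ}
    (Z : Ω → EuclideanSpace ℝ (Fin p)) : Matrix (Fin p) (Fin p) ℝ :=
  Matrix.of fun j l => cov[fun ω => Z ω j, fun ω => Z ω l; μ]

/-- Sub-Gaussian designs: in every task the rows are independent, centred, have covariance matrix
`S k`, and every one-dimensional marginal in a unit direction is sub-Gaussian with variance proxy
`κ`; all eigenvalues of all the matrices `S k` lie in `[1 / c, c]`. -/
structure SubGaussianDesigns {Ω : Type u} [MeasurableSpace Ω] (μ : Measure Ω) {K p nT nS : ℕ}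
    (c : ℝ) (κ : ℝ≥0) (S : Fin (K + 1) → Matrix (Fin p) (Fin p) ℝ)
    (X : (k : Fin (K + 1)) → Fin (sampleSize nT nS k) → Ω → EuclideanSpace ℝ (Fin p)) :
    Prop where
  measurable : ∀ k i, Measurable (X k i)
  indep : ∀ k, iIndepFun (X k) μ
  mean_zero : ∀ k i j, ∫ ω, X k i ω j ∂μ = 0
  cov_eq : ∀ k i, covMatrix μ (X k i) = S k
  subGaussian : ∀ k i (v : EuclideanSpace ℝ (Fin p)), ‖v‖ = 1 →
    HasSubgaussianMGF (fun ω => inner ℝ (X k i ω) v) κ μ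
  eigenvalue_bounds : ∀ k (ev : ℝ), Module.End.HasEigenvalue (Matrix.toLin' (S k)) ev →
    1 / c ≤ ev ∧ ev ≤ c

/-- Gaussian errors: all the errors, over all tasks and all observations, are jointly independent
centred Gaussian variables with variances at most `V`, and they are independent of the designs. -/
structure GaussianErrors {Ω : Type u} [MeasurableSpace Ω] (μ : Measure Ω) {K p nT nS : ℕ}
    (V : ℝ≥0)
    (X : (k : Fin (K + 1)) → Fin (sampleSize nT nS k) → Ω → EuclideanSpace ℝ (Fin p))
    (ε : (k : Fin (K + 1)) → Fin (sampleSize nT nS k) → Ω → ℝ) : Prop where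
  measurable : ∀ k i, Measurable (ε k i)
  indep : iIndepFun
    (fun (q : Σ k : Fin (K + 1), Fin (sampleSize nT nS k)) (ω : Ω) => ε q.1 q.2 ω) μ
  gaussian : ∀ k i, ∃ v : ℝ≥0, v ≤ V ∧ μ.map (ε k i) = gaussianReal 0 v
  indep_design : IndepFun
    (fun (ω : Ω) (q : Σ k : Fin (K + 1), Fin (sampleSize nT nS k)) => X q.1 q.2 ω)
    (fun (ω : Ω) (q : Σ k : Fin (K + 1), Fin (sampleSize nT nS k)) => ε q.1 q.2 ω) μ

/-- The responses of the linear models: `y k i = ⟨x k i, β k⟩ + e k i`. -/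
def response {K p nT nS : ℕ} (β : Fin (K + 1) → EuclideanSpace ℝ (Fin p))
    (x : (k : Fin (K + 1)) → Fin (sampleSize nT nS k) → EuclideanSpace ℝ (Fin p))
    (e : (k : Fin (K + 1)) → Fin (sampleSize nT nS k) → ℝ) :
    (k : Fin (K + 1)) → Fin (sampleSize nT nS k) → ℝ :=
  fun k i => inner ℝ (x k i) (β k) + e k i

/-- The co-training objective
`(1 / 2N) ∑ₖ ‖y k - x k b k‖₂² + lam (‖b 0‖₁ + ∑_{k ≥ 1} a k ‖b k - b 0‖₁)`. -/
def objective {K p nT nS : ℕ} (lam : ℝ) (a : Fin K → ℝ)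
    (x : (k : Fin (K + 1)) → Fin (sampleSize nT nS k) → EuclideanSpace ℝ (Fin p))
    (y : (k : Fin (K + 1)) → Fin (sampleSize nT nS k) → ℝ)
    (b : Fin (K + 1) → EuclideanSpace ℝ (Fin p)) : ℝ :=
  1 / (2 * (totalSize K nT nS : ℝ)) * ∑ k, ∑ i, (y k i - inner ℝ (x k i) (b k)) ^ 2
    + lam * (l1Norm (b 0) + ∑ k : Fin K, a k * l1Norm (b k.succ - b 0))

/-- The set of global minimizers of the co-training objective. -/
def argminSet {K p nT nS : ℕ} (lam : ℝ) (a : Fin K → ℝ)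
    (x : (k : Fin (K + 1)) → Fin (sampleSize nT nS k) → EuclideanSpace ℝ (Fin p))
    (y : (k : Fin (K + 1)) → Fin (sampleSize nT nS k) → ℝ) :
    Set (Fin (K + 1) → EuclideanSpace ℝ (Fin p)) :=
  {b | ∀ b', objective lam a x y b ≤ objective lam a x y b'}

/-- The weighted average `(nS / N) ∑_{k ≥ 1} b k + (nT / N) b 0` of the task parameters. -/
def average {K p : ℕ} (nT nS : ℕ) (b : Fin (K + 1) → EuclideanSpace ℝ (Fin p)) :
    EuclideanSpace ℝ (Fin p) :=
  ((nS : ℝ) / (totalSize K nT nS : ℝ)) • ∑ k : Fin K, b k.succ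
    + ((nT : ℝ) / (totalSize K nT nS : ℝ)) • b 0

/-- The vector `(nS / N) ∑_{k ≥ 1} (b k - b 0)`, whose `ℓ₁`-norm measures the lack of diversity of
the source tasks. -/
def averageContrast {K p : ℕ} (nT nS : ℕ) (b : Fin (K + 1) → EuclideanSpace ℝ (Fin p)) :
    EuclideanSpace ℝ (Fin p) :=
  ((nS : ℝ) / (totalSize K nT nS : ℝ)) • ∑ k : Fin K, (b k.succ - b 0)

/-- `hBar = (nS / N) ∑_{k ≥ 1} h k`. -/
def hBar {K : ℕ} (nT nS : ℕ) (h : Fin K → ℝ) : ℝ :=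
  (nS : ℝ) / (totalSize K nT nS : ℝ) * ∑ k, h k

/-- `vₙ = √(K² log p / nS) hBar`. -/
def vn {K : ℕ} (p nT nS : ℕ) (h : Fin K → ℝ) : ℝ :=
  √((K : ℝ) ^ 2 * Real.log p / nS) * hBar nT nS h

/-- The rate `s log p / N + (1 + vₙ) hBar √(log p / nS)`. -/
def rate {K : ℕ} (p s nT nS : ℕ) (h : Fin K → ℝ) : ℝ :=
  s * Real.log p / (totalSize K nT nS : ℝ)
    + (1 + vn p nT nS h) * hBar nT nS h * √(Real.log p / nS)

end

end TransFusion

/-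
The co-training objective has two noise terms with different scales, a pooled one of order
`√(N log p)` and one per source task of order `√(nS log p)`; the weights `8 √(nS / N)` make the
penalty dominate both, so the basic inequality confines the error `u = b - β` to a cone in which
`u 0` and the contrasts `u k - u 0` are controlled in `ℓ₁`-norm by `√s ‖average u‖` and the
heterogeneity `∑ₖ ‖β k - β 0‖₁`.

The curvature comes from one task at a time: every task satisfies
`α nₖ ‖v‖² ≤ ∑ᵢ ⟨xᵢ, v⟩² + r ‖v‖₁²` for all `v` with `r` of order `log p`. For an average of `m`
signed coordinate vectors this is a lower-tail bound and a union bound over `(2p)^m` points;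
Maurey's sampling argument transfers it to all `v` at the price `‖v‖₁² nₖ / m`. Weighting the tasks
by `nₖ` and applying Cauchy-Schwarz, the losses of all tasks together amount to
`(K log p / N) ‖u 0‖₁²`, which on the cone is absorbed when `nS` exceeds a multiple of `s log p`.
-/

namespace TransFusion

section Sampling

variable {E ι : Type*} [AddCommGroup E] [Module ℝ E] [Fintype ι]

lemma exists_le_weighted_sum {q : ι → ℝ} (hq : ∀ j, 0 ≤ q j) (hq1 : ∑ j, q j = 1) (f : ι → ℝ) :
    ∃ j, f j ≤ ∑ j, q j * f j := by
  obtain ⟨j, -, hj⟩ := (concaveOn_id convex_univ).exists_le_of_centerMass (t := Finset.univ)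
    (p := f) (fun j _ => hq j) (by simp [hq1]) fun j _ => Set.mem_univ (f j)
  exact ⟨j, by simpa [Finset.centerMass, hq1] using hj⟩

lemma weighted_sum_bilin_add (B : E →ₗ[ℝ] E →ₗ[ℝ] ℝ) {q : ι → ℝ} (hq1 : ∑ j, q j = 1) {ξ : ι → E}
    {x : E} (hx : ∑ j, q j • ξ j = x) (u : E) :
    ∑ j, q j * B (u + ξ j) (u + ξ j) =
      B (u + x) (u + x) + (∑ j, q j * B (ξ j) (ξ j) - B x x) := by
  have hleft : ∑ j, q j * B u (ξ j) = B u x := by simp [← hx, map_sum]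
  have hright : ∑ j, q j * B (ξ j) u = B x u := by simp [← hx, map_sum, LinearMap.sum_apply]
  calc ∑ j, q j * B (u + ξ j) (u + ξ j)
      = ∑ j, (q j * B u u + q j * B u (ξ j) + q j * B (ξ j) u + q j * B (ξ j) (ξ j)) := by
        refine Finset.sum_congr rfl fun j _ => ?_
        simp only [map_add, LinearMap.add_apply]
        ring
    _ = B (u + x) (u + x) + (∑ j, q j * B (ξ j) (ξ j) - B x x) := by
        simp only [Finset.sum_add_distrib, ← Finset.sum_mul, hq1, hleft, hright, map_add,
          LinearMap.add_apply]
        ring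

/- The probabilistic method without probability: the points of the sum are chosen one at a time,
each at most as bad as an average choice. -/
lemma exists_bilin_sum_le (B : E →ₗ[ℝ] E →ₗ[ℝ] ℝ) {q : ι → ℝ} (hq : ∀ j, 0 ≤ q j)
    (hq1 : ∑ j, q j = 1) {ξ : ι → E} {x : E} (hx : ∑ j, q j • ξ j = x) (m : ℕ) (z : E) :
    ∃ ω : Fin m → ι, B (z + ∑ i, ξ (ω i)) (z + ∑ i, ξ (ω i)) ≤
      B (z + (m : ℝ) • x) (z + (m : ℝ) • x) + m * (∑ j, q j * B (ξ j) (ξ j) - B x x) := by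
  induction m generalizing z with
  | zero => exact ⟨Fin.elim0, by simp⟩
  | succ m ih =>
    obtain ⟨j, hj⟩ := exists_le_weighted_sum hq hq1 fun j =>
      B (z + (m : ℝ) • x + ξ j) (z + (m : ℝ) • x + ξ j)
    rw [weighted_sum_bilin_add B hq1 hx] at hj
    obtain ⟨ω, hω⟩ := ih (z + ξ j)
    rw [show z + ξ j + (m : ℝ) • x = z + (m : ℝ) • x + ξ j by abel] at hω
    refine ⟨Fin.cons j ω, ?_⟩
    have hsum : z + ∑ i, ξ ((Fin.cons j ω : Fin (m + 1) → ι) i) = z + ξ j + ∑ i, ξ (ω i) := by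
      simp [Fin.sum_univ_succ, add_assoc]
    have hstep : z + ((m + 1 : ℕ) : ℝ) • x = z + (m : ℝ) • x + x := by
      rw [Nat.cast_succ, add_smul, one_smul, add_assoc]
    rw [hsum, hstep]
    push_cast
    linarith

end Sampling

section SignedBasis

variable {p m : ℕ}

/-- The signed standard basis vector `e_j` or `-e_j` of `ℝ^p`; these are the extreme points of the
`ℓ₁` unit ball. The sign is `+` for `true`. -/
noncomputable def signedBasis (b : Fin p × Bool) : EuclideanSpace ℝ (Fin p) :=
  (if b.2 then (1 : ℝ) else -1) • EuclideanSpace.single b.1 1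

/-- The sum of the signed standard basis vectors selected by `ω`. -/
noncomputable def signedSum (ω : Fin m → Fin p × Bool) : EuclideanSpace ℝ (Fin p) :=
  ∑ i, signedBasis (ω i)

lemma bilin_signedBasis (B : EuclideanSpace ℝ (Fin p) →ₗ[ℝ] EuclideanSpace ℝ (Fin p) →ₗ[ℝ] ℝ)
    (b : Fin p × Bool) :
    B (signedBasis b) (signedBasis b) =
      B (EuclideanSpace.single b.1 1) (EuclideanSpace.single b.1 1) := by
  cases hb : b.2 <;> simp [signedBasis, hb]

lemma l1Norm_nonneg (v : EuclideanSpace ℝ (Fin p)) : 0 ≤ l1Norm v :=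
  Finset.sum_nonneg fun _ _ => abs_nonneg _

lemma eq_zero_of_l1Norm_eq_zero {x : EuclideanSpace ℝ (Fin p)} (hx : l1Norm x = 0) : x = 0 := by
  ext j
  simpa using (Finset.sum_eq_zero_iff_of_nonneg fun j _ => abs_nonneg (x j)).1 hx j
    (Finset.mem_univ j)

lemma exists_convex_combination_signedBasis {x : EuclideanSpace ℝ (Fin p)} (hx : 0 < l1Norm x) :
    ∃ q : Fin p × Bool → ℝ, (∀ b, 0 ≤ q b) ∧ ∑ b, q b = 1 ∧
      ∑ b, q b • l1Norm x • signedBasis b = x := by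
  refine ⟨fun b => (if b.2 then (x b.1)⁺ else (x b.1)⁻) / l1Norm x, fun b => ?_, ?_, ?_⟩
  · rcases b with ⟨j, _ | _⟩
    · exact div_nonneg (negPart_nonneg (x j)) hx.le
    · exact div_nonneg (posPart_nonneg (x j)) hx.le
  · rw [← Finset.sum_div, div_eq_one_iff_eq hx.ne', Fintype.sum_prod_type]
    simp [posPart_add_negPart, l1Norm]
  · ext j
    simp [smul_smul, hx.ne', Fintype.sum_prod_type, signedBasis, Pi.single_apply,
      ← sub_eq_add_neg]

lemma bilin_ge_of_signedSum_nonneg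
    (B : EuclideanSpace ℝ (Fin p) →ₗ[ℝ] EuclideanSpace ℝ (Fin p) →ₗ[ℝ] ℝ) {D : ℝ}
    (hD : ∀ j, B (EuclideanSpace.single j 1) (EuclideanSpace.single j 1) ≤ D) (hm : 0 < m)
    (hB : ∀ ω : Fin m → Fin p × Bool, 0 ≤ B (signedSum ω) (signedSum ω))
    (x : EuclideanSpace ℝ (Fin p)) :
    -(D * l1Norm x ^ 2) ≤ ((m : ℝ) - 1) * B x x := by
  rcases (l1Norm_nonneg x).eq_or_lt' with hx | hx
  · simp [eq_zero_of_l1Norm_eq_zero hx, l1Norm]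
  obtain ⟨q, hq, hq1, hqx⟩ := exists_convex_combination_signedBasis hx
  obtain ⟨ω, hω⟩ := exists_bilin_sum_le B hq hq1 hqx m 0
  have hdiag : ∑ b, q b * B (l1Norm x • signedBasis b) (l1Norm x • signedBasis b) ≤
      D * l1Norm x ^ 2 := by
    calc ∑ b, q b * B (l1Norm x • signedBasis b) (l1Norm x • signedBasis b)
        ≤ ∑ b, q b * (D * l1Norm x ^ 2) := by
          refine Finset.sum_le_sum fun b _ => mul_le_mul_of_nonneg_left ?_ (hq b)
          simp only [map_smul, LinearMap.smul_apply, smul_eq_mul, bilin_signedBasis]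
          nlinarith [mul_le_mul_of_nonneg_right (hD b.1) (sq_nonneg (l1Norm x))]
      _ = D * l1Norm x ^ 2 := by rw [← Finset.sum_mul, hq1, one_mul]
  have hsum : 0 ≤ B (∑ i, l1Norm x • signedBasis (ω i)) (∑ i, l1Norm x • signedBasis (ω i)) := by
    rw [← Finset.smul_sum]
    simp only [map_smul, LinearMap.smul_apply, smul_eq_mul]
    exact mul_nonneg hx.le (mul_nonneg hx.le (hB ω))
  simp only [zero_add, map_smul, LinearMap.smul_apply, smul_eq_mul] at hω hdiag
  have hm' : (0 : ℝ) < m := Nat.cast_pos.2 hm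
  have hmul : 0 ≤ (m : ℝ) * (((m : ℝ) - 1) * B x x + D * l1Norm x ^ 2) := by
    nlinarith [mul_le_mul_of_nonneg_left hdiag hm'.le]
  linarith [nonneg_of_mul_nonneg_right hmul hm']

end SignedBasis

lemma lintegral_exp_sq_div_four_gaussianReal_le :
    ∫⁻ g, ENNReal.ofReal (Real.exp (g ^ 2 / 4)) ∂gaussianReal 0 1 ≤ 2 := by
  have hdensity : ∀ g : ℝ, gaussianPDF 0 1 g * ENNReal.ofReal (Real.exp (g ^ 2 / 4)) =
      ENNReal.ofReal ((√(2 * Real.pi))⁻¹ * Real.exp (-(1 / 4) * g ^ 2)) := by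
    intro g
    rw [gaussianPDF, gaussianPDFReal, ← ENNReal.ofReal_mul (by positivity), mul_assoc,
      ← Real.exp_add]
    simp only [NNReal.coe_one, mul_one, sub_zero]
    congr 3
    ring
  rw [gaussianReal_of_var_ne_zero 0 one_ne_zero,
    lintegral_withDensity_eq_lintegral_mul _ (measurable_gaussianPDF _ _) (by fun_prop)]
  simp only [Pi.mul_apply, hdensity]
  rw [← ofReal_integral_eq_lintegral_ofReal
    ((integrable_exp_neg_mul_sq (by norm_num)).const_mul _) (ae_of_all _ fun g => by positivity),
    integral_const_mul, integral_gaussian]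
  have hconst : (√(2 * Real.pi))⁻¹ * √(Real.pi / (1 / 4)) ≤ 2 := by
    rw [← Real.sqrt_inv, ← Real.sqrt_mul (by positivity)]
    refine Real.sqrt_le_iff.2 ⟨by norm_num, ?_⟩
    field_simp
    norm_num
  simpa using ENNReal.ofReal_le_ofReal hconst

section SubGaussian

variable {Ω : Type*} [MeasurableSpace Ω] {μ : Measure Ω} {Z : Ω → ℝ} {κ : ℝ≥0}

lemma hasSubgaussianMGF_mono {κ' : ℝ≥0} (hZ : HasSubgaussianMGF Z κ μ) (hκ : κ ≤ κ') :
    HasSubgaussianMGF Z κ' μ where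
  integrable_exp_mul := hZ.integrable_exp_mul
  mgf_le t := (hZ.mgf_le t).trans <| by gcongr

/- With `g` a standard Gaussian variable independent of `Z`, `exp (Z² / 4κ) = E_g exp (s Z g)` for
`s² = 1 / 2κ`; integrating over `Z` first leaves the Gaussian integral of `exp (g² / 4)`. -/
lemma lintegral_exp_sq_le_of_hasSubgaussianMGF [SFinite μ] (hκ : 0 < κ) (hZm : Measurable Z)
    (hZ : HasSubgaussianMGF Z κ μ) :
    ∫⁻ ω, ENNReal.ofReal (Real.exp (1 / (4 * κ) * Z ω ^ 2)) ∂μ ≤ 2 := by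
  have : (0 : ℝ) < κ := by exact_mod_cast hκ
  set s : ℝ := √(1 / (2 * κ))
  have hs2 : s ^ 2 = 1 / (2 * κ) := Real.sq_sqrt (by positivity)
  have hlinearize : ∀ ω, ENNReal.ofReal (Real.exp (1 / (4 * κ) * Z ω ^ 2)) =
      ∫⁻ g, ENNReal.ofReal (Real.exp (s * Z ω * g)) ∂gaussianReal 0 1 := by
    intro ω
    have hmgf := congrFun (mgf_fun_id_gaussianReal (μ := 0) (v := 1)) (s * Z ω)
    rw [← ofReal_integral_eq_lintegral_ofReal (integrable_exp_mul_gaussianReal _)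
      (ae_of_all _ fun g => (Real.exp_pos _).le)]
    rw [mgf] at hmgf
    rw [hmgf]
    congr 2
    simp only [zero_mul, NNReal.coe_one, one_mul, zero_add, mul_pow, hs2]
    field_simp
    ring
  simp only [hlinearize]
  rw [lintegral_lintegral_swap (by fun_prop)]
  refine (lintegral_mono fun g => ?_).trans lintegral_exp_sq_div_four_gaussianReal_le
  simp only [fun ω => mul_right_comm s (Z ω) g]
  rw [← ofReal_integral_eq_lintegral_ofReal (hZ.integrable_exp_mul _)
      (ae_of_all _ fun g => (Real.exp_pos _).le)]
  refine ENNReal.ofReal_le_ofReal ((hZ.mgf_le _).trans (Real.exp_le_exp.2 (le_of_eq ?_)))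
  rw [mul_pow, hs2]
  field_simp
  ring

lemma integrable_exp_sq_of_hasSubgaussianMGF [SFinite μ] (hκ : 0 < κ) (hZm : Measurable Z)
    (hZ : HasSubgaussianMGF Z κ μ) :
    Integrable (fun ω => Real.exp (1 / (4 * κ) * Z ω ^ 2)) μ := by
  refine ⟨by fun_prop, ?_⟩
  rw [hasFiniteIntegral_iff_ofReal (ae_of_all _ fun g => (Real.exp_pos _).le)]
  exact (lintegral_exp_sq_le_of_hasSubgaussianMGF hκ hZm hZ).trans_lt (by simp)

lemma mgf_sq_le_of_hasSubgaussianMGF [SFinite μ] (hκ : 0 < κ) (hZm : Measurable Z)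
    (hZ : HasSubgaussianMGF Z κ μ) :
    mgf (fun ω => Z ω ^ 2) μ (1 / (4 * κ)) ≤ 2 := by
  rw [mgf, integral_eq_lintegral_of_nonneg_ae (ae_of_all _ fun g => (Real.exp_pos _).le)
    (by fun_prop)]
  exact ENNReal.toReal_le_of_le_ofReal (by norm_num)
    ((lintegral_exp_sq_le_of_hasSubgaussianMGF hκ hZm hZ).trans (by simp))

lemma pow_four_le_exp_add_exp_neg (x : ℝ) : x ^ 4 ≤ 24 * (Real.exp x + Real.exp (-x)) := by
  wlog hx : 0 ≤ x with H
  · have := H (-x) (by linarith)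
    simp only [neg_neg] at this
    nlinarith
  have hexp := Real.pow_div_factorial_le_exp x hx 4
  norm_num [Nat.factorial] at hexp
  linarith [Real.exp_pos (-x)]

lemma integrable_pow_of_hasSubgaussianMGF (hZ : HasSubgaussianMGF Z κ μ) (n : ℕ) :
    Integrable (fun ω => Z ω ^ n) μ :=
  integrable_pow_of_mem_interior_integrableExpSet
    (by simp [HasSubgaussianMGF.integrableExpSet_eq_univ hZ]) n

lemma integral_pow_four_le_of_hasSubgaussianMGF (hZ : HasSubgaussianMGF Z κ μ) :
    ∫ ω, Z ω ^ 4 ∂μ ≤ 48 * Real.exp (κ / 2) := by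
  have hint_pos := hZ.integrable_exp_mul 1
  have hint_neg := hZ.integrable_exp_mul (-1)
  have hmgf_pos := hZ.mgf_le 1
  have hmgf_neg := hZ.mgf_le (-1)
  simp only [mgf, one_mul, neg_one_mul, one_pow, mul_one, even_two, Even.neg_pow] at *
  calc ∫ ω, Z ω ^ 4 ∂μ ≤ ∫ ω, 24 * (Real.exp (Z ω) + Real.exp (-Z ω)) ∂μ :=
        integral_mono (integrable_pow_of_hasSubgaussianMGF hZ 4)
          ((hint_pos.add hint_neg).const_mul _) fun ω => pow_four_le_exp_add_exp_neg _
    _ = 24 * (∫ ω, Real.exp (Z ω) ∂μ + ∫ ω, Real.exp (-Z ω) ∂μ) := by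
        rw [integral_const_mul, integral_add hint_pos hint_neg]
    _ ≤ 48 * Real.exp (κ / 2) := by linarith

end SubGaussian

section Tails

variable {Ω ι : Type*} [MeasurableSpace Ω] {μ : Measure Ω} [Fintype ι]

lemma measureReal_le_sum_sq_le_exp [IsProbabilityMeasure μ] {Z : ι → Ω → ℝ} {κ : ℝ≥0} (hκ : 0 < κ)
    (hZm : ∀ i, Measurable (Z i)) (hind : iIndepFun Z μ)
    (hZ : ∀ i, HasSubgaussianMGF (Z i) κ μ) (r : ℝ) :
    μ.real {ω | 4 * κ * (Fintype.card ι + r) ≤ ∑ i, Z i ω ^ 2} ≤ Real.exp (-r) := by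
  have : (0 : ℝ) < κ := by exact_mod_cast hκ
  have hm : ∀ i, Measurable (fun ω => Z i ω ^ 2) := fun i => (hZm i).pow_const 2
  have hind2 : iIndepFun (fun i ω => Z i ω ^ 2) μ :=
    hind.comp (fun _ x => x ^ 2) (fun _ => by fun_prop)
  have hprod : ∏ i, mgf (fun ω => Z i ω ^ 2) μ (1 / (4 * κ)) ≤ Real.exp (Fintype.card ι) := by
    calc ∏ i, mgf (fun ω => Z i ω ^ 2) μ (1 / (4 * κ)) ≤ ∏ _i : ι, Real.exp 1 :=
          Finset.prod_le_prod (fun i _ => mgf_nonneg) fun i _ =>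
            (mgf_sq_le_of_hasSubgaussianMGF hκ (hZm i) (hZ i)).trans
              (by linarith [Real.add_one_le_exp 1])
      _ = Real.exp (Fintype.card ι) := by simp
  have hchernoff := measure_ge_le_exp_mul_mgf (μ := μ) (X := ∑ i, fun ω => Z i ω ^ 2)
    (t := 1 / (4 * κ)) (4 * κ * (Fintype.card ι + r)) (by positivity)
    (hind2.integrable_exp_mul_sum hm
      fun i _ => integrable_exp_sq_of_hasSubgaussianMGF hκ (hZm i) (hZ i))
  rw [hind2.mgf_sum hm] at hchernoff
  simp only [Finset.sum_apply] at hchernoff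
  calc μ.real {ω | 4 * κ * (Fintype.card ι + r) ≤ ∑ i, Z i ω ^ 2}
      ≤ Real.exp (-(1 / (4 * κ)) * (4 * κ * (Fintype.card ι + r))) *
          Real.exp (Fintype.card ι) := hchernoff.trans (by gcongr)
    _ = Real.exp (-r) := by
        rw [← Real.exp_add]
        congr 1
        field_simp
        ring

lemma exp_neg_le_one_sub_add_sq {y : ℝ} (hy : 0 ≤ y) : Real.exp (-y) ≤ 1 - y + y ^ 2 / 2 := by
  have hquad : 1 + y + y ^ 2 / 2 ≤ Real.exp y := Real.quadratic_le_exp_of_nonneg hy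
  have hpos : 0 < 1 - y + y ^ 2 / 2 := by nlinarith [sq_nonneg (y - 1)]
  rw [Real.exp_neg, inv_le_comm₀ (Real.exp_pos _) hpos]
  refine le_trans ?_ hquad
  rw [inv_le_iff_one_le_mul₀ hpos]
  nlinarith [sq_nonneg (y ^ 2)]

lemma mgf_neg_le_of_nonneg [IsProbabilityMeasure μ] {Y : Ω → ℝ} (hY : MemLp Y 2 μ)
    (hY0 : ∀ ω, 0 ≤ Y ω) {α B l : ℝ} (hα : α ≤ ∫ ω, Y ω ∂μ) (hB : ∫ ω, Y ω ^ 2 ∂μ ≤ B)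
    (hl : 0 ≤ l) :
    mgf Y μ (-l) ≤ Real.exp (-(l * α) + l ^ 2 * B / 2) := by
  have hint : Integrable (fun ω => 1 - l * Y ω) μ :=
    (integrable_const _).sub ((hY.integrable one_le_two).const_mul _)
  have hint2 : Integrable (fun ω => l ^ 2 / 2 * Y ω ^ 2) μ := hY.integrable_sq.const_mul _
  calc ∫ ω, Real.exp (-l * Y ω) ∂μ ≤ ∫ ω, ((1 - l * Y ω) + l ^ 2 / 2 * Y ω ^ 2) ∂μ := by
        refine integral_mono_of_nonneg (ae_of_all _ fun ω => (Real.exp_pos _).le)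
          (hint.add hint2) (ae_of_all _ fun ω => ?_)
        have := exp_neg_le_one_sub_add_sq (mul_nonneg hl (hY0 ω))
        rw [← neg_mul] at this
        exact this.trans (le_of_eq (by ring))
    _ = (1 - l * ∫ ω, Y ω ∂μ) + l ^ 2 / 2 * ∫ ω, Y ω ^ 2 ∂μ := by
        rw [integral_add hint hint2, integral_sub (integrable_const _)
          ((hY.integrable one_le_two).const_mul _), integral_const_mul, integral_const_mul]
        simp
    _ ≤ (1 - l * α) + l ^ 2 / 2 * B := by gcongr
    _ ≤ Real.exp (-(l * α) + l ^ 2 * B / 2) := by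
        linarith [Real.add_one_le_exp (-(l * α) + l ^ 2 * B / 2)]

lemma measureReal_sum_le_le_exp_of_nonneg [IsProbabilityMeasure μ] {Y : ι → Ω → ℝ}
    (hYm : ∀ i, Measurable (Y i)) (hind : iIndepFun Y μ) (hY : ∀ i, MemLp (Y i) 2 μ)
    (hY0 : ∀ i ω, 0 ≤ Y i ω) {α B : ℝ} (hα : 0 ≤ α) (hB : 0 < B)
    (hYα : ∀ i, α ≤ ∫ ω, Y i ω ∂μ) (hYB : ∀ i, ∫ ω, Y i ω ^ 2 ∂μ ≤ B) :
    μ.real {ω | ∑ i, Y i ω ≤ α / 4 * Fintype.card ι} ≤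
      Real.exp (-(α ^ 2 / (4 * B) * Fintype.card ι)) := by
  set l := α / B with hl
  have hl0 : 0 ≤ l := by positivity
  have hint : ∀ i, Integrable (fun ω => Real.exp (-l * Y i ω)) μ := fun i =>
    Integrable.of_bound (by fun_prop) 1 (ae_of_all _ fun ω => by
      rw [Real.norm_eq_abs, Real.abs_exp, Real.exp_le_one_iff, neg_mul]
      exact neg_nonpos.2 (mul_nonneg hl0 (hY0 i ω)))
  have hprod : ∏ i, mgf (Y i) μ (-l) ≤
      Real.exp (Fintype.card ι * (-(l * α) + l ^ 2 * B / 2)) := by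
    calc ∏ i, mgf (Y i) μ (-l) ≤ ∏ _i : ι, Real.exp (-(l * α) + l ^ 2 * B / 2) :=
          Finset.prod_le_prod (fun i _ => mgf_nonneg) fun i _ =>
            mgf_neg_le_of_nonneg (hY i) (hY0 i) (hYα i) (hYB i) hl0
      _ = Real.exp (Fintype.card ι * (-(l * α) + l ^ 2 * B / 2)) := by simp [← Real.exp_nat_mul]
  have hchernoff := measure_le_le_exp_mul_mgf (μ := μ) (X := ∑ i, Y i) (t := -l)
    (α / 4 * Fintype.card ι) (neg_nonpos.2 hl0)
    (hind.integrable_exp_mul_sum hYm fun i _ => hint i)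
  rw [hind.mgf_sum hYm] at hchernoff
  simp only [Finset.sum_apply] at hchernoff
  calc μ.real {ω | ∑ i, Y i ω ≤ α / 4 * Fintype.card ι}
      ≤ Real.exp (- -l * (α / 4 * Fintype.card ι)) *
          Real.exp (Fintype.card ι * (-(l * α) + l ^ 2 * B / 2)) := hchernoff.trans (by gcongr)
    _ = Real.exp (-(α ^ 2 / (4 * B) * Fintype.card ι)) := by
        rw [← Real.exp_add, hl]
        congr 1
        field_simp
        ring

/-- The exponential rate in the lower tail of a sum of squares of independent variables that are
sub-Gaussian with variance proxy `κ` and have second moments at least `α`. -/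
noncomputable def lowerTailRate (α : ℝ) (κ : ℝ≥0) : ℝ := α ^ 2 / (4 * (48 * Real.exp (κ / 2)))

lemma lowerTailRate_pos {α : ℝ} (hα : 0 < α) (κ : ℝ≥0) : 0 < lowerTailRate α κ := by
  unfold lowerTailRate; positivity

lemma measureReal_sum_sq_le_le_exp [IsProbabilityMeasure μ] {Z : ι → Ω → ℝ} {κ : ℝ≥0}
    (hZm : ∀ i, Measurable (Z i)) (hind : iIndepFun Z μ)
    (hZ : ∀ i, HasSubgaussianMGF (Z i) κ μ) {α : ℝ} (hα : 0 ≤ α)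
    (hZα : ∀ i, α ≤ ∫ ω, Z i ω ^ 2 ∂μ) :
    μ.real {ω | ∑ i, Z i ω ^ 2 ≤ α / 4 * Fintype.card ι} ≤
      Real.exp (-(lowerTailRate α κ * Fintype.card ι)) := by
  have hpow : ∀ x : ℝ, (x ^ 2) ^ 2 = x ^ 4 := fun x => by ring
  refine measureReal_sum_le_le_exp_of_nonneg (fun i => (hZm i).pow_const 2)
    (hind.comp (fun _ x => x ^ 2) fun _ => by fun_prop) (fun i => ?_)
    (fun i ω => sq_nonneg (Z i ω)) hα (by positivity) hZα fun i => ?_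
  · rw [memLp_two_iff_integrable_sq (by fun_prop)]
    simpa only [hpow] using integrable_pow_of_hasSubgaussianMGF (hZ i) 4
  · simpa only [hpow] using integral_pow_four_le_of_hasSubgaussianMGF (hZ i)

end Tails

lemma norm_le_l1Norm {p : ℕ} (v : EuclideanSpace ℝ (Fin p)) : ‖v‖ ≤ l1Norm v := by
  refine (abs_le_of_sq_le_sq' ?_ (l1Norm_nonneg v)).2
  rw [EuclideanSpace.real_norm_sq_eq, l1Norm]
  calc ∑ i, v i ^ 2 = ∑ i, |v i| ^ 2 := by simp
    _ ≤ (∑ i, |v i|) ^ 2 := Finset.sum_sq_le_sq_sum_of_nonneg fun i _ => abs_nonneg _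

section RestrictedStrongConvexity

variable {n p : ℕ} {x : Fin n → EuclideanSpace ℝ (Fin p)} {α r : ℝ}

/-- Restricted strong convexity of the least-squares loss of a design with rows `x i`: its
quadratic form dominates `α n ‖v‖₂²` up to the loss `r ‖v‖₁²`. No cone condition is imposed on `v`;
the loss term is small on vectors that are approximately sparse. -/
def RestrictedStronglyConvex (α r : ℝ) (x : Fin n → EuclideanSpace ℝ (Fin p)) : Prop :=
  ∀ v, α * n * ‖v‖ ^ 2 ≤ ∑ i, inner ℝ (x i) v ^ 2 + r * l1Norm v ^ 2

lemma RestrictedStronglyConvex.mono {r' : ℝ} (hx : RestrictedStronglyConvex α r x) (hr : r ≤ r') :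
    RestrictedStronglyConvex α r' x :=
  fun v => (hx v).trans (by gcongr)

lemma restrictedStronglyConvex_of_mul_le (hr : 0 ≤ r) (hαr : α * n ≤ r) :
    RestrictedStronglyConvex α r x := fun v =>
  calc α * n * ‖v‖ ^ 2 ≤ r * l1Norm v ^ 2 := by gcongr; exact norm_le_l1Norm v
    _ ≤ ∑ i, inner ℝ (x i) v ^ 2 + r * l1Norm v ^ 2 :=
        le_add_of_nonneg_left (Finset.sum_nonneg fun i _ => sq_nonneg _)

lemma restrictedStronglyConvex_of_signedSum {m : ℕ} {D : ℝ} (hm : 1 < m) (hα : 0 ≤ α)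
    (hcol : ∀ j, ∑ i, x i j ^ 2 ≤ D)
    (hx : ∀ ω : Fin m → Fin p × Bool,
      α * n * ‖signedSum ω‖ ^ 2 ≤ ∑ i, inner ℝ (x i) (signedSum ω) ^ 2) :
    RestrictedStronglyConvex α (D / ((m : ℝ) - 1)) x := by
  intro v
  set B : EuclideanSpace ℝ (Fin p) →ₗ[ℝ] EuclideanSpace ℝ (Fin p) →ₗ[ℝ] ℝ :=
    ∑ i, (innerₗ _ (x i)).smulRight (innerₗ _ (x i)) - (α * n) • innerₗ _ with hBdef
  have hB : ∀ w, B w w = ∑ i, inner ℝ (x i) w ^ 2 - α * n * ‖w‖ ^ 2 := by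
    intro w
    simp [hBdef, LinearMap.sum_apply, pow_two]
  have hdiag : ∀ j, B (EuclideanSpace.single j 1) (EuclideanSpace.single j 1) ≤ D := by
    intro j
    simp only [hB, EuclideanSpace.inner_single_right, one_mul, conj_trivial]
    exact (sub_le_self _ (by positivity)).trans (hcol j)
  have hm1 : (0 : ℝ) < m - 1 := sub_pos.2 (by exact_mod_cast hm)
  have hlower := bilin_ge_of_signedSum_nonneg B hdiag (zero_lt_one.trans hm)
    (fun ω => by rw [hB]; exact sub_nonneg.2 (hx ω)) v
  rw [hB] at hlower
  rw [← sub_le_iff_le_add', div_mul_eq_mul_div, le_div_iff₀' hm1]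
  linarith

end RestrictedStrongConvexity

/-- `Z` is an independent sample of random vectors in `ℝ^p` with one-dimensional marginals that are
sub-Gaussian with variance proxy `κ` in unit directions and with second-moment matrices bounded
below by `α`. The vectors need not be identically distributed. -/
structure SubGaussianSample {Ω : Type*} [MeasurableSpace Ω] (μ : Measure Ω) {n p : ℕ} (α : ℝ)
    (κ : ℝ≥0) (Z : Fin n → Ω → EuclideanSpace ℝ (Fin p)) : Prop where
  measurable : ∀ i, Measurable (Z i)
  indep : iIndepFun Z μ
  subGaussian : ∀ i (v : EuclideanSpace ℝ (Fin p)), ‖v‖ = 1 →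
    HasSubgaussianMGF (fun ω => inner ℝ (Z i ω) v) κ μ
  mul_norm_sq_le : ∀ i (v : EuclideanSpace ℝ (Fin p)),
    α * ‖v‖ ^ 2 ≤ ∫ ω, inner ℝ (Z i ω) v ^ 2 ∂μ

/-- The loss constant in the restricted strong convexity of a sub-Gaussian sample that holds up to
probability `p ^ (-R)`. The first summand comes from large samples, the second one from samples of
size `O(log p)`. -/
noncomputable def curvatureLoss (α : ℝ) (κ : ℝ≥0) (R : ℝ) : ℝ :=
  8 * (4 * κ * (1 + lowerTailRate α κ)) / lowerTailRate α κ
    + α / 4 * ((16 + 2 * R) / lowerTailRate α κ)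

lemma curvatureLoss_nonneg {α R : ℝ} (hα : 0 < α) (κ : ℝ≥0) (hR : 0 ≤ R) :
    0 ≤ curvatureLoss α κ R := by
  have := lowerTailRate_pos hα κ
  unfold curvatureLoss
  positivity

lemma quarter_mul_le_curvatureLoss {α R y L : ℝ} (hα : 0 < α) (κ : ℝ≥0) (hL : 0 ≤ L)
    (hy : lowerTailRate α κ * y ≤ (16 + 2 * R) * L) : α / 4 * y ≤ curvatureLoss α κ R * L := by
  have hγ := lowerTailRate_pos hα κ
  have hfirst : 0 ≤ 8 * (4 * κ * (1 + lowerTailRate α κ)) / lowerTailRate α κ * L := by positivity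
  have hy' : y ≤ (16 + 2 * R) / lowerTailRate α κ * L := by
    rwa [div_mul_eq_mul_div, le_div_iff₀' hγ]
  have hsecond : α / 4 * y ≤ α / 4 * ((16 + 2 * R) / lowerTailRate α κ) * L := by
    rw [mul_assoc]
    gcongr
  rw [curvatureLoss, add_mul]
  linarith

lemma mul_add_le_curvatureLoss_mul {α R y L t : ℝ} (hα : 0 < α) (κ : ℝ≥0) (hR : 0 ≤ R)
    (hy : R * L ≤ lowerTailRate α κ * y) (ht0 : 0 ≤ t) (ht : lowerTailRate α κ * y / 8 ≤ t) :
    4 * κ * (y + R * L) ≤ curvatureLoss α κ R * t := by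
  have hγ := lowerTailRate_pos hα κ
  have hsecond : 0 ≤ α / 4 * ((16 + 2 * R) / lowerTailRate α κ) * t := by positivity
  calc 4 * κ * (y + R * L) ≤ 4 * κ * (y + lowerTailRate α κ * y) := by gcongr
    _ = 8 * (4 * κ * (1 + lowerTailRate α κ)) / lowerTailRate α κ *
          (lowerTailRate α κ * y / 8) := by field_simp
    _ ≤ 8 * (4 * κ * (1 + lowerTailRate α κ)) / lowerTailRate α κ * t := by gcongr
    _ ≤ curvatureLoss α κ R * t := by
        rw [curvatureLoss, add_mul]
        exact le_add_of_nonneg_right hsecond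

lemma exists_nat_mul_le_div_four {y L : ℝ} (hL : 0 < L) (hy : 16 * L ≤ y) :
    ∃ m : ℕ, 1 < m ∧ m * L ≤ y / 4 ∧ y / 8 ≤ (m - 1) * L := by
  have hy0 : 0 ≤ y := by nlinarith
  have hle : (⌊y / 4 / L⌋₊ : ℝ) ≤ y / 4 / L := Nat.floor_le (by positivity)
  have hlt : y / 4 / L < ⌊y / 4 / L⌋₊ + 1 := Nat.lt_floor_add_one _
  rw [le_div_iff₀ hL] at hle
  rw [div_lt_iff₀ hL] at hlt
  refine ⟨⌊y / 4 / L⌋₊, ?_, hle, by linarith⟩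
  by_contra! hcon
  have : (⌊y / 4 / L⌋₊ : ℝ) ≤ 1 := by exact_mod_cast hcon
  nlinarith

namespace SubGaussianSample

variable {Ω : Type*} [MeasurableSpace Ω] {μ : Measure Ω} [IsProbabilityMeasure μ] {n p : ℕ}
  {α : ℝ} {κ : ℝ≥0} {Z : Fin n → Ω → EuclideanSpace ℝ (Fin p)}

omit [IsProbabilityMeasure μ] in
lemma mono {κ' : ℝ≥0} (hZ : SubGaussianSample μ α κ Z) (hκ : κ ≤ κ') :
    SubGaussianSample μ α κ' Z where
  measurable := hZ.measurable
  indep := hZ.indep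
  subGaussian i v hv := hasSubgaussianMGF_mono (hZ.subGaussian i v hv) hκ
  mul_norm_sq_le := hZ.mul_norm_sq_le

lemma measureReal_le_column_sq_le (hZ : SubGaussianSample μ α κ Z) (hκ : 0 < κ) (j : Fin p)
    (r : ℝ) :
    μ.real {ω | 4 * κ * (n + r) ≤ ∑ i, Z i ω j ^ 2} ≤ Real.exp (-r) := by
  have htail := measureReal_le_sum_sq_le_exp (Z := fun i ω => Z i ω j) hκ
    (fun i => by have := hZ.measurable i; fun_prop)
    (hZ.indep.comp (fun _ x => x j) fun _ => by fun_prop)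
    (fun i => by
      simpa [EuclideanSpace.inner_single_right] using
        hZ.subGaussian i (EuclideanSpace.single j 1) (by simp)) r
  rwa [Fintype.card_fin] at htail

lemma measureReal_quadratic_lt_le (hZ : SubGaussianSample μ α κ Z) (hα : 0 ≤ α)
    (v : EuclideanSpace ℝ (Fin p)) :
    μ.real {ω | ∑ i, inner ℝ (Z i ω) v ^ 2 < α / 4 * n * ‖v‖ ^ 2} ≤
      Real.exp (-(lowerTailRate α κ * n)) := by
  rcases eq_or_ne v 0 with rfl | hv
  · simpa using (Real.exp_pos _).le
  have hv0 : 0 < ‖v‖ := norm_pos_iff.2 hv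
  obtain ⟨w, hw, hvw⟩ : ∃ w : EuclideanSpace ℝ (Fin p), ‖w‖ = 1 ∧ v = ‖v‖ • w :=
    ⟨‖v‖⁻¹ • v, by simp [norm_smul, hv0.ne'], by simp [smul_smul, hv0.ne']⟩
  have htail := measureReal_sum_sq_le_le_exp (Z := fun i ω => inner ℝ (Z i ω) w)
    (fun i => by have := hZ.measurable i; fun_prop)
    (hZ.indep.comp (fun _ x => inner ℝ x w) fun _ => by fun_prop)
    (fun i => hZ.subGaussian i w hw) hα (fun i => by simpa [hw] using hZ.mul_norm_sq_le i w)
  rw [Fintype.card_fin] at htail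
  refine (measureReal_mono fun ω hω => ?_).trans htail
  have hquad : ∑ i, inner ℝ (Z i ω) v ^ 2 = (∑ i, inner ℝ (Z i ω) w ^ 2) * ‖v‖ ^ 2 := by
    rw [hvw]
    simp only [inner_smul_right, mul_pow, norm_smul, norm_norm, hw, mul_one, Finset.sum_mul]
    exact Finset.sum_congr rfl fun i _ => mul_comm _ _
  rw [Set.mem_ofPred_eq, hquad] at hω
  exact (lt_of_mul_lt_mul_right hω (by positivity)).le

lemma measureReal_exists_signedSum_quadratic_lt_le (hZ : SubGaussianSample μ α κ Z) (hα : 0 ≤ α)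
    (hp : 2 ≤ p) (m : ℕ) :
    μ.real {ω | ∃ b : Fin m → Fin p × Bool,
      ∑ i, inner ℝ (Z i ω) (signedSum b) ^ 2 < α / 4 * n * ‖signedSum b‖ ^ 2} ≤
      Real.exp (2 * (m * Real.log p) - lowerTailRate α κ * n) := by
  have hp2 : (2 : ℝ) ≤ p := by exact_mod_cast hp
  have hcard : (Fintype.card (Fin m → Fin p × Bool) : ℝ) ≤ Real.exp (2 * (m * Real.log p)) := by
    calc (Fintype.card (Fin m → Fin p × Bool) : ℝ) = (p * 2 : ℝ) ^ m := by simp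
      _ ≤ (p * p : ℝ) ^ m := by gcongr
      _ = Real.exp (2 * (m * Real.log p)) := by
          rw [← Real.exp_log (show (0 : ℝ) < (p * p) ^ m by positivity), Real.log_pow,
            Real.log_mul (by positivity) (by positivity)]
          ring_nf
  rw [Set.ofPred_exists, sub_eq_add_neg, Real.exp_add]
  calc μ.real (⋃ b : Fin m → Fin p × Bool,
        {ω | ∑ i, inner ℝ (Z i ω) (signedSum b) ^ 2 < α / 4 * n * ‖signedSum b‖ ^ 2})
      ≤ ∑ _b : Fin m → Fin p × Bool, Real.exp (-(lowerTailRate α κ * n)) :=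
        (measureReal_iUnion_fintype_le _).trans <| Finset.sum_le_sum fun b _ =>
          hZ.measureReal_quadratic_lt_le hα (signedSum b)
    _ = Fintype.card (Fin m → Fin p × Bool) * Real.exp (-(lowerTailRate α κ * n)) := by
        rw [Finset.sum_const, Finset.card_univ, nsmul_eq_mul]
    _ ≤ Real.exp (2 * (m * Real.log p)) * Real.exp (-(lowerTailRate α κ * n)) := by gcongr

/- For samples of size `O(log p)` the loss term alone suffices, as `‖v‖₂ ≤ ‖v‖₁`. For larger ones,
sparse approximation reduces the claim to the `(2p) ^ m` sums of `m ~ n / log p` signed basis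
vectors, few enough for a union bound. -/
lemma measureReal_not_restrictedStronglyConvex_le (hZ : SubGaussianSample μ α κ Z) (hα : 0 < α)
    (hp : 2 ≤ p) {R : ℝ} (hR : 0 ≤ R) :
    μ.real {ω | (∀ j, ∑ i, Z i ω j ^ 2 ≤ 4 * κ * (n + R * Real.log p)) ∧
      ¬ RestrictedStronglyConvex (α / 4) (curvatureLoss α κ R * Real.log p) fun i => Z i ω} ≤
      Real.exp (-(R * Real.log p)) := by
  set γ := lowerTailRate α κ
  set L := Real.log p
  have : 0 < γ := lowerTailRate_pos hα κ
  have hL0 : 0 < L := Real.log_pos (by exact_mod_cast hp)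
  have hRL : 0 ≤ R * L := by positivity
  have hloss := mul_nonneg (curvatureLoss_nonneg hα κ hR) hL0.le
  rcases lt_or_ge (γ * n) ((16 + 2 * R) * L) with hsmall | hlarge
  · have hrsc : ∀ ω, RestrictedStronglyConvex (α / 4) (curvatureLoss α κ R * L) fun i => Z i ω :=
      fun ω => restrictedStronglyConvex_of_mul_le hloss
        (quarter_mul_le_curvatureLoss hα κ hL0.le hsmall.le)
    simpa [hrsc] using (Real.exp_pos _).le
  · obtain ⟨m, hm, hm_le, hm_ge⟩ := exists_nat_mul_le_div_four hL0 (y := γ * n) (by linarith)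
    refine (measureReal_mono ?_).trans ((hZ.measureReal_exists_signedSum_quadratic_lt_le hα.le hp
      m).trans (Real.exp_le_exp.2 (by linarith)))
    rintro ω ⟨hcol, hrsc⟩
    by_contra! hquad
    simp only [Set.mem_ofPred_eq, not_exists, not_lt] at hquad
    refine hrsc ((restrictedStronglyConvex_of_signedSum hm (by positivity) hcol hquad).mono ?_)
    have hm1 : (0 : ℝ) < m - 1 := sub_pos.2 (by exact_mod_cast hm)
    rw [div_le_iff₀ hm1, mul_assoc (curvatureLoss α κ R), mul_comm L]
    exact mul_add_le_curvatureLoss_mul hα κ hR (by linarith) (by positivity) hm_ge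

end SubGaussianSample

section Noise

variable {Ω : Type*} [MeasurableSpace Ω] {μ : Measure Ω}

lemma measureReal_le_abs_le_of_hasSubgaussianMGF [IsProbabilityMeasure μ] {Z : Ω → ℝ} {κ : ℝ≥0}
    (hZ : HasSubgaussianMGF Z κ μ) {r : ℝ} (hr : 0 ≤ r) :
    μ.real {ω | r ≤ |Z ω|} ≤ 2 * Real.exp (-r ^ 2 / (2 * κ)) := by
  have hsub : {ω | r ≤ |Z ω|} ⊆ {ω | r ≤ Z ω} ∪ {ω | r ≤ (-Z) ω} := by
    intro ω hω
    simp only [Set.mem_ofPred_eq, le_abs, Set.mem_union, Pi.neg_apply] at hω ⊢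
    exact hω
  calc μ.real {ω | r ≤ |Z ω|} ≤ μ.real {ω | r ≤ Z ω} + μ.real {ω | r ≤ (-Z) ω} :=
        (measureReal_mono hsub).trans (measureReal_union_le _ _)
    _ ≤ Real.exp (-r ^ 2 / (2 * κ)) + Real.exp (-r ^ 2 / (2 * κ)) :=
        add_le_add (hZ.measure_ge_le hr) (hZ.neg.measure_ge_le hr)
    _ = 2 * Real.exp (-r ^ 2 / (2 * κ)) := by ring

variable {I E F : Type*} [Fintype I] [MeasurableSpace E] [MeasurableSpace F]

lemma hasSubgaussianMGF_sum_mul {e : I → Ω → ℝ} {V : ℝ≥0} (hind : iIndepFun e μ)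
    (he : ∀ q, HasSubgaussianMGF (e q) V μ) (a : I → ℝ) {b : ℝ≥0} (hab : ∑ q, a q ^ 2 ≤ b) :
    HasSubgaussianMGF (fun ω => ∑ q, a q * e q ω) (b * V) μ := by
  have hterm : ∀ q, HasSubgaussianMGF ((fun y => a q * y) ∘ e q) ((a q ^ 2).toNNReal * V) μ := by
    intro q
    refine hasSubgaussianMGF_mono ((he q).const_mul (a q)) (le_of_eq ?_)
    congr 1
    exact (Real.toNNReal_of_nonneg (sq_nonneg _)).symm
  refine hasSubgaussianMGF_mono (HasSubgaussianMGF.sum_of_iIndepFun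
    (hind.comp (fun q y => a q * y) fun q => by fun_prop) (s := Finset.univ)
    fun q _ => hterm q) ?_
  rw [← Finset.sum_mul]
  gcongr
  rw [← NNReal.coe_le_coe, NNReal.coe_sum]
  simpa only [Real.coe_toNNReal _ (sq_nonneg _)] using hab

lemma measureReal_le_of_indepFun_of_section_le [IsProbabilityMeasure μ] {ξ : Ω → E} {e : Ω → F}
    (hξ : Measurable ξ) (he : Measurable e) (h : IndepFun ξ e μ) {B : Set (E × F)}
    (hB : MeasurableSet B) {δ : ℝ} (hδ : 0 ≤ δ) (hsec : ∀ x, μ.real {ω | (x, e ω) ∈ B} ≤ δ) :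
    μ.real {ω | (ξ ω, e ω) ∈ B} ≤ δ := by
  have hmap : μ {ω | (ξ ω, e ω) ∈ B} = (μ.map fun ω => (ξ ω, e ω)) B :=
    (Measure.map_apply (hξ.prodMk he) hB).symm
  have := Measure.isProbabilityMeasure_map (μ := μ) hξ.aemeasurable
  have := Measure.isProbabilityMeasure_map (μ := μ) he.aemeasurable
  rw [(indepFun_iff_map_prod_eq_prod_map_map hξ.aemeasurable he.aemeasurable).1 h,
    Measure.prod_apply hB] at hmap
  rw [measureReal_def, hmap]
  refine ENNReal.toReal_le_of_le_ofReal hδ ?_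
  calc ∫⁻ x, μ.map e (Prod.mk x ⁻¹' B) ∂(μ.map ξ) ≤ ∫⁻ _x, ENNReal.ofReal δ ∂(μ.map ξ) := by
        refine lintegral_mono fun x => ?_
        rw [Measure.map_apply he (measurable_prodMk_left hB)]
        exact (ENNReal.le_ofReal_iff_toReal_le (measure_ne_top _ _) hδ).2 (hsec x)
    _ = ENNReal.ofReal δ := by simp

lemma measureReal_le_abs_sum_random_mul_le [IsProbabilityMeasure μ] {ξ : Ω → E}
    (hξ : Measurable ξ) {e : I → Ω → ℝ} {V : ℝ≥0} (hem : ∀ q, Measurable (e q))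
    (hind : iIndepFun e μ) (he : ∀ q, HasSubgaussianMGF (e q) V μ)
    (hξe : IndepFun ξ (fun ω q => e q ω) μ) {f : I → E → ℝ} (hf : ∀ q, Measurable (f q)) (b : ℝ≥0)
    {r : ℝ} (hr : 0 ≤ r) :
    μ.real {ω | ∑ q, f q (ξ ω) ^ 2 ≤ b ∧ r ≤ |∑ q, f q (ξ ω) * e q ω|} ≤
      2 * Real.exp (-r ^ 2 / (2 * (b * V))) := by
  refine measureReal_le_of_indepFun_of_section_le (B := {z : E × (I → ℝ) |
    ∑ q, f q z.1 ^ 2 ≤ b} ∩ {z | r ≤ |∑ q, f q z.1 * z.2 q|}) hξ (measurable_pi_lambda _ hem) hξe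
    (.inter (measurableSet_le ?_ measurable_const) (measurableSet_le measurable_const ?_))
    (by positivity) fun x => ?_
  · exact Finset.measurable_sum _ fun q _ => ((hf q).comp measurable_fst).pow_const 2
  · exact continuous_abs.measurable.comp (Finset.measurable_sum _ fun q _ =>
      ((hf q).comp measurable_fst).mul ((measurable_pi_apply q).comp measurable_snd))
  by_cases hx : ∑ q, f q x ^ 2 ≤ b
  · simpa [hx] using
      measureReal_le_abs_le_of_hasSubgaussianMGF (hasSubgaussianMGF_sum_mul hind he _ hx) hr
  · simpa [hx] using (Real.exp_pos _).le

end Noise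

/-- Sub-Gaussian errors: all the errors, over all tasks and all observations, are jointly
independent and sub-Gaussian with variance proxy `V`, and they are independent of the designs. -/
structure SubGaussianErrors {Ω : Type*} [MeasurableSpace Ω] (μ : Measure Ω) {K p nT nS : ℕ}
    (V : ℝ≥0)
    (X : (k : Fin (K + 1)) → Fin (sampleSize nT nS k) → Ω → EuclideanSpace ℝ (Fin p))
    (ε : (k : Fin (K + 1)) → Fin (sampleSize nT nS k) → Ω → ℝ) : Prop where
  measurable : ∀ k i, Measurable (ε k i)
  indep : iIndepFun
    (fun (q : Σ k : Fin (K + 1), Fin (sampleSize nT nS k)) (ω : Ω) => ε q.1 q.2 ω) μ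
  subGaussian : ∀ k i, HasSubgaussianMGF (ε k i) V μ
  indep_design : IndepFun
    (fun (ω : Ω) (q : Σ k : Fin (K + 1), Fin (sampleSize nT nS k)) => X q.1 q.2 ω)
    (fun (ω : Ω) (q : Σ k : Fin (K + 1), Fin (sampleSize nT nS k)) => ε q.1 q.2 ω) μ

/-- The constant `c₀` in the regularization parameter `c₀ √(log p / N)`. It is chosen so that the
noise exceeds its bound with probability at most `2 p ^ (-R)`. -/
noncomputable def noiseScale (κ V : ℝ≥0) (R : ℝ) : ℝ := √(8 * (4 * κ * (1 + 2 * R)) * V * R)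

lemma noiseScale_pos {κ V : ℝ≥0} {R : ℝ} (hκ : 0 < κ) (hV : 0 < V) (hR : 0 < R) :
    0 < noiseScale κ V R := by
  unfold noiseScale
  positivity

namespace SubGaussianErrors

variable {Ω : Type*} [MeasurableSpace Ω] {μ : Measure Ω} {K p nT nS : ℕ} {κ V : ℝ≥0}
  {X : (k : Fin (K + 1)) → Fin (sampleSize nT nS k) → Ω → EuclideanSpace ℝ (Fin p)}
  {ε : (k : Fin (K + 1)) → Fin (sampleSize nT nS k) → Ω → ℝ}

lemma mono {V' : ℝ≥0} (hε : SubGaussianErrors μ V X ε) (hV : V ≤ V') :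
    SubGaussianErrors μ V' X ε where
  measurable := hε.measurable
  indep := hε.indep
  subGaussian k i := hasSubgaussianMGF_mono (hε.subGaussian k i) hV
  indep_design := hε.indep_design

lemma measureReal_le_abs_noise_le [IsProbabilityMeasure μ] (hε : SubGaussianErrors μ V X ε)
    (hX : ∀ k i, Measurable (X k i)) (T : Finset (Fin (K + 1))) (j : Fin p) {b r : ℝ}
    (hb : 0 ≤ b) (hr : 0 ≤ r) :
    μ.real {ω | ∑ k ∈ T, ∑ i, X k i ω j ^ 2 ≤ b ∧ r ≤ |∑ k ∈ T, ∑ i, X k i ω j * ε k i ω|} ≤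
      2 * Real.exp (-r ^ 2 / (2 * (b * V))) := by
  lift b to ℝ≥0 using hb
  have htail := measureReal_le_abs_sum_random_mul_le (μ := μ) (V := V)
    (ξ := fun ω (q : Σ k : Fin (K + 1), Fin (sampleSize nT nS k)) => X q.1 q.2 ω)
    (measurable_pi_lambda _ fun q => hX q.1 q.2)
    (fun q => hε.measurable q.1 q.2) hε.indep (fun q => hε.subGaussian q.1 q.2) hε.indep_design
    (f := fun q x => if q.1 ∈ T then x q j else 0)
    (fun q => by split_ifs <;> fun_prop) b hr
  simpa [Fintype.sum_sigma, ite_pow, ite_mul, Finset.sum_ite_irrel, Finset.sum_ite_mem] using htail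

lemma measureReal_noiseScale_le_abs_noise_le [IsProbabilityMeasure μ]
    (hε : SubGaussianErrors μ V X ε) (hX : ∀ k i, Measurable (X k i)) (hκ : 0 < κ) (hV : 0 < V)
    {T : Finset (Fin (K + 1))} {n R L : ℝ} (hn : 0 < n)
    (hTn : ∑ k ∈ T, (sampleSize nT nS k : ℝ) = n) (hTL : T.card * L ≤ 2 * n)
    (hR : 0 ≤ R) (hL : 0 ≤ L) (j : Fin p) :
    μ.real {ω | (∀ k ∈ T, ∑ i, X k i ω j ^ 2 ≤ 4 * κ * (sampleSize nT nS k + R * L)) ∧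
      noiseScale κ V R / 2 * √(n * L) ≤ |∑ k ∈ T, ∑ i, X k i ω j * ε k i ω|} ≤
      2 * Real.exp (-(R * L)) := by
  have : (0 : ℝ) < κ := by exact_mod_cast hκ
  have : (0 : ℝ) < V := by exact_mod_cast hV
  have hb0 : 0 ≤ 4 * κ * (1 + 2 * R) * n := by positivity
  have hscale : noiseScale κ V R ^ 2 = 8 * (4 * κ * (1 + 2 * R)) * V * R :=
    Real.sq_sqrt (by positivity)
  have hscale0 : 0 ≤ noiseScale κ V R := Real.sqrt_nonneg _
  have hexponent : -(noiseScale κ V R / 2 * √(n * L)) ^ 2 /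
      (2 * (4 * κ * (1 + 2 * R) * n * V)) = -(R * L) := by
    rw [mul_pow, Real.sq_sqrt (by positivity), div_pow, hscale]
    field_simp
    ring
  have htail := hε.measureReal_le_abs_noise_le hX T j hb0
    (r := noiseScale κ V R / 2 * √(n * L)) (by positivity)
  rw [hexponent] at htail
  refine (measureReal_mono ?_).trans htail
  rintro ω ⟨hcol, hnoise⟩
  refine ⟨?_, hnoise⟩
  calc ∑ k ∈ T, ∑ i, X k i ω j ^ 2 ≤ ∑ k ∈ T, 4 * κ * (sampleSize nT nS k + R * L) :=
        Finset.sum_le_sum hcol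
    _ = 4 * κ * (n + R * (T.card * L)) := by
        rw [← Finset.mul_sum, Finset.sum_add_distrib, hTn, Finset.sum_const, nsmul_eq_mul]
        ring
    _ ≤ 4 * κ * (n + R * (2 * n)) := by gcongr
    _ = 4 * κ * (1 + 2 * R) * n := by ring

end SubGaussianErrors

lemma mul_sqrt_div_self {x : ℝ} (hx : 0 ≤ x) (y : ℝ) : x * √(y / x) = √(x * y) := by
  rcases hx.eq_or_lt with rfl | hx0
  · simp
  · rw [← Real.sqrt_sq hx, ← Real.sqrt_mul (sq_nonneg x), Real.sqrt_sq hx]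
    congr 1
    field_simp

lemma mul_sqrt_div_mul_sqrt_div {x y : ℝ} (hx : 0 < x) (hy : 0 ≤ y) (z : ℝ) :
    x * (√(y / x) * √(z / x)) = √(z * y) := by
  rw [← Real.sqrt_mul (by positivity), ← Real.sqrt_sq hx.le, ← Real.sqrt_mul (sq_nonneg x),
    Real.sqrt_sq hx.le]
  congr 1
  field_simp

lemma sum_sampleSize {K nT nS : ℕ} :
    ∑ k : Fin (K + 1), (sampleSize nT nS k : ℝ) = totalSize K nT nS := by
  simp [Fin.sum_univ_succ, sampleSize, totalSize, add_comm]

/-- The event on which the deterministic analysis applies: every design is restricted strongly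
convex, and the regularization dominates both the noise pooled over all the tasks and the noise of
each source task. -/
structure GoodEvent {K p nT nS : ℕ} (α r lam a : ℝ)
    (x : (k : Fin (K + 1)) → Fin (sampleSize nT nS k) → EuclideanSpace ℝ (Fin p))
    (e : (k : Fin (K + 1)) → Fin (sampleSize nT nS k) → ℝ) : Prop where
  curvature : ∀ k, RestrictedStronglyConvex α r (x k)
  pooled_noise : ∀ j, |∑ k, ∑ i, x k i j * e k i| ≤ totalSize K nT nS * lam / 2
  source_noise : ∀ (k : Fin K) j,
    |∑ i, x k.succ i j * e k.succ i| ≤ totalSize K nT nS * (lam * a) / 16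

section GoodEventProbability

variable {Ω : Type*} [MeasurableSpace Ω] {μ : Measure Ω}

lemma measureReal_exists_le {ι : Type*} [Fintype ι] {P : ι → Ω → Prop} {δ : ℝ}
    (h : ∀ i, μ.real {ω | P i ω} ≤ δ) : μ.real {ω | ∃ i, P i ω} ≤ Fintype.card ι * δ := by
  rw [Set.ofPred_exists]
  calc μ.real (⋃ i, {ω | P i ω}) ≤ ∑ i, μ.real {ω | P i ω} := measureReal_iUnion_fintype_le _
    _ ≤ ∑ _i : ι, δ := Finset.sum_le_sum fun i _ => h i
    _ = Fintype.card ι * δ := by simp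

lemma exists_measurableSet_of_measureReal_not_le [IsProbabilityMeasure μ] {P : Ω → Prop} {δ : ℝ}
    (h : μ.real {ω | ¬P ω} ≤ δ) : ∃ E, MeasurableSet E ∧ 1 - δ ≤ μ.real E ∧ ∀ ω ∈ E, P ω := by
  refine ⟨(toMeasurable μ {ω | ¬P ω})ᶜ, (measurableSet_toMeasurable _ _).compl, ?_, ?_⟩
  · rw [probReal_compl_eq_one_sub (measurableSet_toMeasurable _ _), measureReal_def,
      measure_toMeasurable, ← measureReal_def]
    exact sub_le_sub_left h 1
  · intro ω hω
    by_contra hP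
    exact hω (subset_toMeasurable μ _ hP)

variable [IsProbabilityMeasure μ] {K p nT nS : ℕ} {α R : ℝ} {κ V : ℝ≥0}
  {X : (k : Fin (K + 1)) → Fin (sampleSize nT nS k) → Ω → EuclideanSpace ℝ (Fin p)}
  {ε : (k : Fin (K + 1)) → Fin (sampleSize nT nS k) → Ω → ℝ}

lemma measureReal_exists_lt_column_sq_le (hX : ∀ k, SubGaussianSample μ α κ (X k)) (hκ : 0 < κ)
    (r : ℝ) :
    μ.real {ω | ∃ k j, 4 * κ * (sampleSize nT nS k + r) < ∑ i, X k i ω j ^ 2} ≤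
      (K + 1) * p * Real.exp (-r) := by
  have hcol : ∀ k j, μ.real {ω | 4 * κ * (sampleSize nT nS k + r) < ∑ i, X k i ω j ^ 2} ≤
      Real.exp (-r) := fun k j =>
    (measureReal_mono (Set.ofPred_subset_ofPred.2 fun ω => le_of_lt)).trans
      ((hX k).measureReal_le_column_sq_le hκ j r)
  simpa [mul_assoc] using measureReal_exists_le fun k => measureReal_exists_le (hcol k)

lemma measureReal_exists_not_restrictedStronglyConvex_le
    (hX : ∀ k, SubGaussianSample μ α κ (X k)) (hα : 0 < α) (hp : 2 ≤ p) (hR : 0 ≤ R) :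
    μ.real {ω | ∃ k, (∀ j, ∑ i, X k i ω j ^ 2 ≤ 4 * κ * (sampleSize nT nS k + R * Real.log p)) ∧
      ¬RestrictedStronglyConvex (α / 4) (curvatureLoss α κ R * Real.log p) fun i => X k i ω} ≤
      (K + 1) * Real.exp (-(R * Real.log p)) := by
  simpa using measureReal_exists_le fun k =>
    (hX k).measureReal_not_restrictedStronglyConvex_le hα hp hR

namespace SubGaussianErrors

lemma measureReal_exists_pooled_noise_lt_le (hε : SubGaussianErrors μ V X ε)
    (hX : ∀ k i, Measurable (X k i)) (hκ : 0 < κ) (hV : 0 < V) (hR : 0 ≤ R) {L : ℝ} (hL : 0 < L)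
    (hK : 1 ≤ K) (hnS : L ≤ nS) :
    μ.real {ω | (∀ k j, ∑ i, X k i ω j ^ 2 ≤ 4 * κ * (sampleSize nT nS k + R * L)) ∧
      ∃ j, totalSize K nT nS * (noiseScale κ V R * √(L / totalSize K nT nS)) / 2 <
        |∑ k, ∑ i, X k i ω j * ε k i ω|} ≤ p * (2 * Real.exp (-(R * L))) := by
  have hK' : (1 : ℝ) ≤ K := by exact_mod_cast hK
  have hN : (totalSize K nT nS : ℝ) = K * nS + nT := by simp [totalSize]
  have : (0 : ℝ) ≤ nT := by positivity
  have hcount : (Finset.univ : Finset (Fin (K + 1))).card * L ≤ 2 * totalSize K nT nS := by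
    rw [Finset.card_fin, hN]
    push_cast
    nlinarith
  have hscale : totalSize K nT nS * (noiseScale κ V R * √(L / totalSize K nT nS)) / 2 =
      noiseScale κ V R / 2 * √(totalSize K nT nS * L) := by
    rw [← mul_sqrt_div_self (Nat.cast_nonneg _)]
    ring
  have hunion := measureReal_exists_le fun j =>
    hε.measureReal_noiseScale_le_abs_noise_le hX hκ hV (T := Finset.univ)
      (by rw [hN]; nlinarith) sum_sampleSize hcount hR hL.le j
  rw [Fintype.card_fin] at hunion
  refine (measureReal_mono ?_).trans hunion
  rintro ω ⟨hcol, j, hj⟩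
  exact ⟨j, fun k _ => hcol k j, hscale ▸ hj.le⟩

lemma measureReal_exists_source_noise_lt_le (hε : SubGaussianErrors μ V X ε)
    (hX : ∀ k i, Measurable (X k i)) (hκ : 0 < κ) (hV : 0 < V) (hR : 0 ≤ R) {L : ℝ} (hL : 0 < L)
    (hnS : L ≤ nS) :
    μ.real {ω | (∀ k j, ∑ i, X k i ω j ^ 2 ≤ 4 * κ * (sampleSize nT nS k + R * L)) ∧
      ∃ (k : Fin K) (j : Fin p), totalSize K nT nS * (noiseScale κ V R *
          √(L / totalSize K nT nS) * (8 * √((nS : ℝ) / totalSize K nT nS))) / 16 <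
        |∑ i, X k.succ i ω j * ε k.succ i ω|} ≤ K * (p * (2 * Real.exp (-(R * L)))) := by
  have hnS0 : (0 : ℝ) < nS := hL.trans_le hnS
  have hscale : 0 < K → totalSize K nT nS * (noiseScale κ V R *
      √(L / totalSize K nT nS) * (8 * √((nS : ℝ) / totalSize K nT nS))) / 16 =
      noiseScale κ V R / 2 * √(nS * L) := by
    intro hK
    have hN : (0 : ℝ) < totalSize K nT nS := by
      rw [totalSize]
      push_cast
      positivity
    rw [← mul_sqrt_div_mul_sqrt_div hN hL.le]
    ring
  have hunion := measureReal_exists_le fun k : Fin K => measureReal_exists_le fun j =>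
    hε.measureReal_noiseScale_le_abs_noise_le hX hκ hV (T := {k.succ}) hnS0
      (by simp [sampleSize]) (by simpa using hnS.trans (by linarith)) hR hL.le j
  simp only [Fintype.card_fin, Finset.sum_singleton, Finset.mem_singleton, forall_eq] at hunion
  refine (measureReal_mono ?_).trans hunion
  rintro ω ⟨hcol, k, j, hj⟩
  exact ⟨k, j, hcol k.succ j, hscale k.pos ▸ hj.le⟩

end SubGaussianErrors

lemma mul_exp_neg_mul_log_le {K p : ℕ} {R : ℝ} (hK : 1 ≤ K) (hp : 1 ≤ p)
    (hKp : Real.log K + 2 * Real.log p ≤ R * Real.log p) :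
    K * p * Real.exp (-(R * Real.log p)) ≤ Real.exp (-Real.log p) := by
  calc K * p * Real.exp (-(R * Real.log p))
      = Real.exp (Real.log K + Real.log p + -(R * Real.log p)) := by
        rw [Real.exp_add, Real.exp_add, Real.exp_log (by exact_mod_cast hK),
          Real.exp_log (by exact_mod_cast hp)]
    _ ≤ Real.exp (-Real.log p) := Real.exp_le_exp.2 (by linarith)

lemma measureReal_not_goodEvent_le (hX : ∀ k, SubGaussianSample μ α κ (X k))
    (hε : SubGaussianErrors μ V X ε) (hα : 0 < α) (hκ : 0 < κ) (hV : 0 < V) (hK : 1 ≤ K)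
    (hp : 2 ≤ p) (hKp : Real.log K + 2 * Real.log p ≤ R * Real.log p) (hnS : Real.log p ≤ nS) :
    μ.real {ω | ¬GoodEvent (α / 4) (curvatureLoss α κ R * Real.log p)
      (noiseScale κ V R * √(Real.log p / totalSize K nT nS))
      (8 * √((nS : ℝ) / totalSize K nT nS)) (fun k i => X k i ω) fun k i => ε k i ω} ≤
      8 * Real.exp (-Real.log p) := by
  have hL : 0 < Real.log p := Real.log_pos (by exact_mod_cast hp)
  have hR : 0 ≤ R := by
    have := Real.log_natCast_nonneg K
    nlinarith
  have hXm := fun k i => (hX k).measurable i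
  have hcol := measureReal_exists_lt_column_sq_le hX hκ (R * Real.log p)
  have hcurv := measureReal_exists_not_restrictedStronglyConvex_le hX hα hp hR
  have hpooled := hε.measureReal_exists_pooled_noise_lt_le hXm hκ hV hR hL hK hnS
  have hsource := hε.measureReal_exists_source_noise_lt_le hXm hκ hV hR hL hnS
  refine (measureReal_mono fun ω hω => ?_).trans ((measureReal_union_le _ _).trans
    (add_le_add ((measureReal_union_le _ _).trans (add_le_add ((measureReal_union_le _ _).trans
      (add_le_add hcol hcurv)) hpooled)) hsource)) |>.trans ?_
  · by_contra hgood
    simp only [Set.mem_union, Set.mem_ofPred_eq, not_or, not_exists, not_and, not_lt,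
      not_not] at hgood
    obtain ⟨⟨⟨hcol', hcurv'⟩, hpooled'⟩, hsource'⟩ := hgood
    exact hω ⟨fun k => hcurv' k (hcol' k), hpooled' hcol', hsource' hcol'⟩
  · have hbound := mul_exp_neg_mul_log_le hK (one_le_two.trans hp) hKp
    set δ := Real.exp (-(R * Real.log p))
    have hδ : 0 ≤ δ := (Real.exp_pos _).le
    have hK' : (1 : ℝ) ≤ K := by exact_mod_cast hK
    have hp' : (2 : ℝ) ≤ p := by exact_mod_cast hp
    have hδK : 0 ≤ (K - 1) * (p * δ) := mul_nonneg (by linarith) (by positivity)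
    have hδp : 0 ≤ K * δ * (p - 2) := mul_nonneg (by positivity) (by linarith)
    have hKδ : 0 ≤ (K - 1) * δ := mul_nonneg (by linarith) hδ
    linarith

end GoodEventProbability

section GaussianModel

open scoped Matrix in
lemma mul_norm_sq_le_dotProduct_of_eigenvalue_ge {p : ℕ} {S : Matrix (Fin p) (Fin p) ℝ}
    (hS : S.IsHermitian) {α : ℝ}
    (hα : ∀ ev : ℝ, Module.End.HasEigenvalue (Matrix.toLin' S) ev → α ≤ ev)
    (v : EuclideanSpace ℝ (Fin p)) : α * ‖v‖ ^ 2 ≤ v.ofLp ⬝ᵥ S *ᵥ v.ofLp := by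
  have hpos : (S - algebraMap ℝ _ α).PosSemidef := by
    refine Matrix.posSemidef_iff_isHermitian_and_spectrum_nonneg.2 ⟨hS.sub ?_, ?_⟩
    · rw [Matrix.algebraMap_eq_diagonal]
      exact Matrix.isHermitian_diagonal _
    · rw [← spectrum.sub_singleton_eq, ← Matrix.spectrum_toLin']
      rintro _ ⟨ev, hev, _, rfl, rfl⟩
      exact sub_nonneg.2 (hα ev (Module.End.hasEigenvalue_iff_mem_spectrum.2 hev))
  have hquad := hpos.dotProduct_mulVec_nonneg v.ofLp
  rw [Matrix.sub_mulVec, dotProduct_sub, Algebra.algebraMap_eq_smul_one, Matrix.smul_mulVec,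
    Matrix.one_mulVec, dotProduct_smul, star_trivial, sub_nonneg] at hquad
  simpa [EuclideanSpace.real_norm_sq_eq, dotProduct, ← pow_two] using hquad

variable {Ω : Type*} [MeasurableSpace Ω] {μ : Measure Ω}

open scoped Matrix in
lemma integral_inner_sq_eq {p : ℕ} [IsProbabilityMeasure μ] {Z : Ω → EuclideanSpace ℝ (Fin p)}
    (hmean : ∀ j, ∫ ω, Z ω j ∂μ = 0) (hL2 : ∀ j, MemLp (fun ω => Z ω j) 2 μ)
    (v : EuclideanSpace ℝ (Fin p)) :
    ∫ ω, inner ℝ (Z ω) v ^ 2 ∂μ = v.ofLp ⬝ᵥ covMatrix μ Z *ᵥ v.ofLp := by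
  have hinner : (fun ω => inner ℝ (Z ω) v) = fun ω => ∑ j, v j * Z ω j := by
    simp [PiLp.inner_apply]
  have hL : ∀ j, MemLp (fun ω => v j * Z ω j) 2 μ := fun j => (hL2 j).const_mul (v j)
  have hm : AEMeasurable (fun ω => inner ℝ (Z ω) v) μ := by
    rw [hinner]
    exact Finset.aemeasurable_fun_sum _ fun j _ => (hL j).1.aemeasurable
  have hmean_inner : ∫ ω, inner ℝ (Z ω) v ∂μ = 0 := by
    rw [hinner, integral_finsetSum _ fun j _ => (hL j).integrable one_le_two]
    simp [integral_const_mul, hmean]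
  rw [← variance_of_integral_eq_zero hm hmean_inner, ← covariance_self hm, hinner,
    covariance_fun_sum_fun_sum hL hL]
  simp only [covariance_const_mul_left, covariance_const_mul_right, dotProduct, Matrix.mulVec,
    covMatrix, Matrix.of_apply, Finset.mul_sum, mul_comm, mul_left_comm]

variable {K p nT nS : ℕ} {c : ℝ} {κ V : ℝ≥0} {S : Fin (K + 1) → Matrix (Fin p) (Fin p) ℝ}
  {X : (k : Fin (K + 1)) → Fin (sampleSize nT nS k) → Ω → EuclideanSpace ℝ (Fin p)}
  {ε : (k : Fin (K + 1)) → Fin (sampleSize nT nS k) → Ω → ℝ}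

lemma SubGaussianDesigns.subGaussianSample [IsProbabilityMeasure μ]
    (hX : SubGaussianDesigns μ c κ S X) (k : Fin (K + 1)) :
    SubGaussianSample μ (1 / c) κ (X k) where
  measurable := hX.measurable k
  indep := hX.indep k
  subGaussian := hX.subGaussian k
  mul_norm_sq_le i v := by
    have hL2 : ∀ j, MemLp (fun ω => X k i ω j) 2 μ := fun j => by
      have hsub := (hX.subGaussian k i (EuclideanSpace.single j 1) (by simp)).memLp 2
      simpa [EuclideanSpace.inner_single_right] using hsub
    have hsymm : (S k).IsHermitian := by
      rw [← hX.cov_eq k i]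
      ext a b
      simp [covMatrix, covariance_comm]
    rw [integral_inner_sq_eq (hX.mean_zero k i) hL2, hX.cov_eq k i]
    exact mul_norm_sq_le_dotProduct_of_eigenvalue_ge hsymm
      (fun ev hev => (hX.eigenvalue_bounds k ev hev).1) v

lemma hasSubgaussianMGF_of_map_eq_gaussianReal {Z : Ω → ℝ} {v : ℝ≥0} (hZ : AEMeasurable Z μ)
    (hlaw : μ.map Z = gaussianReal 0 v) : HasSubgaussianMGF Z v μ where
  integrable_exp_mul t := by
    have hint := integrable_exp_mul_gaussianReal (μ := 0) (v := v) t
    rwa [← hlaw, integrable_map_measure (by fun_prop) hZ] at hint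
  mgf_le t := by
    rw [mgf_gaussianReal hlaw, zero_mul, zero_add]

lemma GaussianErrors.subGaussianErrors (hε : GaussianErrors μ V X ε) :
    SubGaussianErrors μ V X ε where
  measurable := hε.measurable
  indep := hε.indep
  subGaussian k i :=
    let ⟨_, hv, hlaw⟩ := hε.gaussian k i
    hasSubgaussianMGF_mono
      (hasSubgaussianMGF_of_map_eq_gaussianReal (hε.measurable k i).aemeasurable hlaw) hv
  indep_design := hε.indep_design

end GaussianModel

section DeterministicAnalysis

variable {K p nT nS : ℕ}

lemma l1Norm_sub_comm (v w : EuclideanSpace ℝ (Fin p)) : l1Norm (v - w) = l1Norm (w - v) :=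
  Finset.sum_congr rfl fun j _ => by simp [abs_sub_comm]

lemma l1Norm_add_le (v w : EuclideanSpace ℝ (Fin p)) :
    l1Norm (v + w) ≤ l1Norm v + l1Norm w := by
  simp only [l1Norm, ← Finset.sum_add_distrib]
  exact Finset.sum_le_sum fun j _ => abs_add_le _ _

lemma l1Norm_sub_l1Norm_le {T : Finset (Fin p)} {v : EuclideanSpace ℝ (Fin p)}
    (hT : ∀ j ∉ T, v j = 0) (w : EuclideanSpace ℝ (Fin p)) :
    l1Norm v - l1Norm w ≤ ∑ j ∈ T, |(w - v) j| - ∑ j ∈ Tᶜ, |(w - v) j| := by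
  have hon : ∑ j ∈ T, |v j| - ∑ j ∈ T, |w j| ≤ ∑ j ∈ T, |(w - v) j| := by
    rw [← Finset.sum_sub_distrib]
    refine Finset.sum_le_sum fun j _ => ?_
    rw [PiLp.sub_apply, abs_sub_comm]
    exact abs_sub_abs_le_abs_sub _ _
  have hoff : ∑ j ∈ Tᶜ, |v j| - ∑ j ∈ Tᶜ, |w j| = -∑ j ∈ Tᶜ, |(w - v) j| := by
    rw [← Finset.sum_sub_distrib, ← Finset.sum_neg_distrib]
    refine Finset.sum_congr rfl fun j hj => ?_
    simp [hT j (Finset.mem_compl.1 hj)]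
  rw [l1Norm, l1Norm, ← Finset.sum_add_sum_compl T, ← Finset.sum_add_sum_compl T (fun j => |w j|)]
  linarith

lemma sum_abs_le_sqrt_card_mul_norm (T : Finset (Fin p)) (v : EuclideanSpace ℝ (Fin p)) :
    ∑ j ∈ T, |v j| ≤ √T.card * ‖v‖ := by
  refine (abs_le_of_sq_le_sq' ?_ (by positivity)).2
  rw [mul_pow, Real.sq_sqrt (Nat.cast_nonneg _), EuclideanSpace.real_norm_sq_eq]
  calc (∑ j ∈ T, |v j|) ^ 2 ≤ T.card * ∑ j ∈ T, |v j| ^ 2 := sq_sum_le_card_mul_sum_sq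
    _ ≤ T.card * ∑ j, v j ^ 2 := by
      simp only [sq_abs]
      gcongr
      exact Finset.subset_univ _

/-- The total contrast `∑_{k ≥ 1} ‖u k - u 0‖₁` between the source and the target vectors: the
quantity that the co-training objective penalizes. -/
noncomputable def totalContrast (u : Fin (K + 1) → EuclideanSpace ℝ (Fin p)) : ℝ :=
  ∑ k : Fin K, l1Norm (u k.succ - u 0)

lemma totalContrast_nonneg (u : Fin (K + 1) → EuclideanSpace ℝ (Fin p)) : 0 ≤ totalContrast u :=
  Finset.sum_nonneg fun _ _ => l1Norm_nonneg _

lemma totalContrast_sub_le (u v : Fin (K + 1) → EuclideanSpace ℝ (Fin p)) :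
    totalContrast (u - v) ≤ totalContrast u + totalContrast v := by
  simp only [totalContrast, ← Finset.sum_add_distrib]
  refine Finset.sum_le_sum fun k _ => ?_
  rw [l1Norm_sub_comm (v k.succ), Pi.sub_apply, Pi.sub_apply, sub_sub_sub_comm,
    ← neg_sub (v 0), sub_neg_eq_add]
  exact l1Norm_add_le _ _

section Average

variable (u v : Fin (K + 1) → EuclideanSpace ℝ (Fin p))

lemma average_sub : average nT nS (u - v) = average nT nS u - average nT nS v := by
  simp only [average, Pi.sub_apply, Finset.sum_sub_distrib, smul_sub]
  abel

lemma totalSize_smul_average (hN : (totalSize K nT nS : ℝ) ≠ 0) :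
    (totalSize K nT nS : ℝ) • average nT nS u = ∑ k, (sampleSize nT nS k : ℝ) • u k := by
  simp [average, Fin.sum_univ_succ, sampleSize, smul_smul, mul_div_cancel₀ _ hN, add_comm,
    Finset.smul_sum]

lemma totalSize_mul_norm_average_le (hN : (totalSize K nT nS : ℝ) ≠ 0) :
    totalSize K nT nS * ‖average nT nS u‖ ≤ ∑ k, sampleSize nT nS k * ‖u k‖ := by
  calc totalSize K nT nS * ‖average nT nS u‖ = ‖∑ k, (sampleSize nT nS k : ℝ) • u k‖ := by
        rw [← totalSize_smul_average u hN, norm_smul, Real.norm_natCast]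
    _ ≤ ∑ k, ‖(sampleSize nT nS k : ℝ) • u k‖ := norm_sum_le _ _
    _ = ∑ k, sampleSize nT nS k * ‖u k‖ := by simp only [norm_smul, Real.norm_natCast]

lemma average_eq_add_averageContrast (hN : (totalSize K nT nS : ℝ) ≠ 0) :
    average nT nS u = u 0 + averageContrast nT nS u := by
  have hweights : (nT : ℝ) / totalSize K nT nS + (nS : ℝ) / totalSize K nT nS * K = 1 := by
    rw [div_mul_eq_mul_div, ← add_div, div_eq_one_iff_eq hN, totalSize]
    push_cast
    ring
  simp only [average, averageContrast, Finset.sum_sub_distrib, Finset.sum_const, Finset.card_univ,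
    Fintype.card_fin, ← Nat.cast_smul_eq_nsmul ℝ]
  linear_combination (norm := module) hweights • u 0

lemma l1Norm_averageContrast_le :
    l1Norm (averageContrast nT nS u) ≤ (nS : ℝ) / totalSize K nT nS * totalContrast u := by
  simp only [l1Norm, averageContrast, totalContrast, PiLp.smul_apply, WithLp.ofLp_sum,
    Finset.sum_apply, smul_eq_mul, abs_mul]
  rw [Finset.sum_comm, ← Finset.mul_sum, abs_of_nonneg (by positivity)]
  gcongr
  exact Finset.abs_sum_le_sum_abs _ _

lemma sum_abs_le_norm_average (T : Finset (Fin p)) (hN : (totalSize K nT nS : ℝ) ≠ 0) :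
    ∑ j ∈ T, |u 0 j| ≤ √T.card * ‖average nT nS u‖ +
      (nS : ℝ) / totalSize K nT nS * totalContrast u := by
  calc ∑ j ∈ T, |u 0 j|
      ≤ ∑ j ∈ T, (|average nT nS u j| + |averageContrast nT nS u j|) := by
        refine Finset.sum_le_sum fun j _ => ?_
        rw [average_eq_add_averageContrast u hN, PiLp.add_apply]
        simpa using abs_sub (u 0 j + averageContrast nT nS u j) (averageContrast nT nS u j)
    _ ≤ ∑ j ∈ T, |average nT nS u j| + l1Norm (averageContrast nT nS u) := by
        rw [Finset.sum_add_distrib]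
        gcongr
        exact Finset.sum_le_sum_of_subset_of_nonneg (Finset.subset_univ _)
          fun _ _ _ => abs_nonneg _
    _ ≤ _ := add_le_add (sum_abs_le_sqrt_card_mul_norm T _) (l1Norm_averageContrast_le u)

end Average

section BasicInequality

variable {lam a : ℝ} {x : (k : Fin (K + 1)) → Fin (sampleSize nT nS k) → EuclideanSpace ℝ (Fin p)}
  {e : (k : Fin (K + 1)) → Fin (sampleSize nT nS k) → ℝ}
  {β b : Fin (K + 1) → EuclideanSpace ℝ (Fin p)}

/-- The in-sample prediction error `(1 / N) ∑ₖ ∑ᵢ ⟨x k i, u k⟩²` of the estimation errors `u k`. -/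
noncomputable def predictionError
    (x : (k : Fin (K + 1)) → Fin (sampleSize nT nS k) → EuclideanSpace ℝ (Fin p))
    (u : Fin (K + 1) → EuclideanSpace ℝ (Fin p)) : ℝ :=
  (∑ k, ∑ i, inner ℝ (x k i) (u k) ^ 2) / totalSize K nT nS

lemma predictionError_nonneg (u : Fin (K + 1) → EuclideanSpace ℝ (Fin p)) :
    0 ≤ predictionError x u := by
  unfold predictionError
  positivity

lemma sum_mul_inner_le {ι : Type*} [Fintype ι] {z : ι → EuclideanSpace ℝ (Fin p)} {c : ι → ℝ}
    {G : ℝ} (hG : ∀ j, |∑ i, z i j * c i| ≤ G) (v : EuclideanSpace ℝ (Fin p)) :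
    ∑ i, c i * inner ℝ (z i) v ≤ G * l1Norm v := by
  calc ∑ i, c i * inner ℝ (z i) v = ∑ j, (∑ i, z i j * c i) * v j := by
        simp only [PiLp.inner_apply, Finset.mul_sum, Finset.sum_mul]
        rw [Finset.sum_comm]
        exact Finset.sum_congr rfl fun j _ => Finset.sum_congr rfl fun i _ => by
          simp only [RCLike.inner_apply, conj_trivial]
          ring
    _ ≤ G * l1Norm v := by
        rw [l1Norm, Finset.mul_sum]
        refine Finset.sum_le_sum fun j _ => (le_abs_self _).trans ?_
        rw [abs_mul]
        exact mul_le_mul_of_nonneg_right (hG j) (abs_nonneg _)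

lemma sum_noise_le {G₀ G₁ : ℝ} (hpooled : ∀ j, |∑ k, ∑ i, x k i j * e k i| ≤ G₀)
    (hsource : ∀ (k : Fin K) j, |∑ i, x k.succ i j * e k.succ i| ≤ G₁)
    (u : Fin (K + 1) → EuclideanSpace ℝ (Fin p)) :
    ∑ k, ∑ i, e k i * inner ℝ (x k i) (u k) ≤ G₀ * l1Norm (u 0) + G₁ * totalContrast u := by
  have hsplit : ∑ k, ∑ i, e k i * inner ℝ (x k i) (u k) =
      ∑ q : Σ k : Fin (K + 1), Fin (sampleSize nT nS k), e q.1 q.2 * inner ℝ (x q.1 q.2) (u 0) +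
        ∑ k : Fin K, ∑ i, e k.succ i * inner ℝ (x k.succ i) (u k.succ - u 0) := by
    simp only [inner_sub_right, mul_sub, Finset.sum_sub_distrib, Fintype.sum_sigma,
      Fin.sum_univ_succ]
    ring
  rw [hsplit, totalContrast, Finset.mul_sum]
  refine add_le_add (sum_mul_inner_le (fun j => ?_) _)
    (Finset.sum_le_sum fun k _ => sum_mul_inner_le (hsource k) _)
  rw [Fintype.sum_sigma]
  exact hpooled j

lemma sum_sq_residual :
    ∑ k, ∑ i, (response β x e k i - inner ℝ (x k i) (b k)) ^ 2 =
      ∑ k, ∑ i, e k i ^ 2 - 2 * ∑ k, ∑ i, e k i * inner ℝ (x k i) ((b - β) k) +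
        ∑ k, ∑ i, inner ℝ (x k i) ((b - β) k) ^ 2 := by
  simp only [response, Finset.mul_sum, ← Finset.sum_sub_distrib, ← Finset.sum_add_distrib]
  refine Finset.sum_congr rfl fun k _ => Finset.sum_congr rfl fun i _ => ?_
  rw [Pi.sub_apply, inner_sub_right]
  ring

lemma predictionError_le_of_mem_argminSet (hb : b ∈ argminSet lam (fun _ => a) x (response β x e)) :
    predictionError x (b - β) ≤
      2 * ((∑ k, ∑ i, e k i * inner ℝ (x k i) ((b - β) k)) / totalSize K nT nS +
        lam * (l1Norm (β 0) - l1Norm (b 0) + a * (totalContrast β - totalContrast b))) := by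
  have hmin := hb β
  simp only [objective, sum_sq_residual, ← Finset.mul_sum, sub_self,
    Pi.zero_apply, inner_zero_right, mul_zero, Finset.sum_const_zero, sub_zero, ne_eq,
    OfNat.ofNat_ne_zero, not_false_eq_true, zero_pow, add_zero] at hmin
  rw [predictionError, totalContrast, totalContrast]
  linear_combination 2 * hmin

lemma GoodEvent.predictionError_le {α r : ℝ} (hG : GoodEvent α r lam a x e) (hlam : 0 ≤ lam)
    (ha : 0 ≤ a) (hN : (0 : ℝ) < totalSize K nT nS) {T : Finset (Fin p)} (hT : ∀ j ∉ T, β 0 j = 0)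
    (hb : b ∈ argminSet lam (fun _ => a) x (response β x e)) :
    predictionError x (b - β) ≤
      lam * (3 * ∑ j ∈ T, |(b - β) 0 j| - ∑ j ∈ Tᶜ, |(b - β) 0 j| +
        a * (4 * totalContrast β - 15 / 8 * totalContrast (b - β))) := by
  have hsplit : l1Norm ((b - β) 0) = ∑ j ∈ T, |(b - β) 0 j| + ∑ j ∈ Tᶜ, |(b - β) 0 j| :=
    (Finset.sum_add_sum_compl T _).symm
  have hnoise : (∑ k, ∑ i, e k i * inner ℝ (x k i) ((b - β) k)) / totalSize K nT nS ≤
      lam / 2 * l1Norm ((b - β) 0) + lam * a / 16 * totalContrast (b - β) := by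
    rw [div_le_iff₀ hN]
    linarith [sum_noise_le hG.pooled_noise hG.source_noise (b - β)]
  have hsparse := mul_le_mul_of_nonneg_left (l1Norm_sub_l1Norm_le hT (b 0)) hlam
  have hcontrast := mul_le_mul_of_nonneg_left (totalContrast_sub_le b β) (mul_nonneg hlam ha)
  have hbasic := predictionError_le_of_mem_argminSet hb
  rw [hsplit] at hnoise
  simp only [Pi.sub_apply] at hnoise hbasic ⊢
  linarith

end BasicInequality

section AverageCurvature

lemma sqrt_add_le_add_sqrt {a b : ℝ} (ha : 0 ≤ a) (hb : 0 ≤ b) : √(a + b) ≤ √a + √b := by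
  refine Real.sqrt_le_iff.2 ⟨by positivity, ?_⟩
  rw [add_sq, Real.sq_sqrt ha, Real.sq_sqrt hb]
  linarith [mul_nonneg (Real.sqrt_nonneg a) (Real.sqrt_nonneg b)]

lemma mul_sum_mul_sq_le {ι : Type*} [Fintype ι] {α r : ℝ} {n t q l : ι → ℝ} (hα : 0 ≤ α)
    (hr : 0 ≤ r) (hn : ∀ k, 0 ≤ n k) (ht : ∀ k, 0 ≤ t k) (hq : ∀ k, 0 ≤ q k) (hl : ∀ k, 0 ≤ l k)
    (h : ∀ k, α * n k * t k ^ 2 ≤ q k + r * l k ^ 2) :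
    α * (∑ k, n k * t k) ^ 2 ≤
      2 * ((∑ k, n k) * ∑ k, q k) + 2 * r * (∑ k, √(n k) * l k) ^ 2 := by
  have hterm : ∀ k, √α * (n k * t k) ≤ √(n k) * √(q k) + √r * (√(n k) * l k) := fun k =>
    calc √α * (n k * t k) = √(n k) * √(α * n k * t k ^ 2) := by
          rw [Real.sqrt_mul (mul_nonneg hα (hn k)), Real.sqrt_mul hα, Real.sqrt_sq (ht k)]
          linear_combination -(√α * t k) * Real.mul_self_sqrt (hn k)
      _ ≤ √(n k) * (√(q k) + √(r * l k ^ 2)) := by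
          gcongr
          exact (Real.sqrt_le_sqrt (h k)).trans (sqrt_add_le_add_sqrt (hq k) (by positivity))
      _ = √(n k) * √(q k) + √r * (√(n k) * l k) := by
          rw [Real.sqrt_mul hr, Real.sqrt_sq (hl k)]
          ring
  have hsum : √α * ∑ k, n k * t k ≤ ∑ k, √(n k) * √(q k) + √r * ∑ k, √(n k) * l k := by
    simp only [Finset.mul_sum, ← Finset.sum_add_distrib]
    exact Finset.sum_le_sum fun k _ => hterm k
  have hcauchy : (∑ k, √(n k) * √(q k)) ^ 2 ≤ (∑ k, n k) * ∑ k, q k := by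
    simpa only [Real.sq_sqrt (hn _), Real.sq_sqrt (hq _)] using
      Finset.sum_mul_sq_le_sq_mul_sq Finset.univ (fun k => √(n k)) fun k => √(q k)
  have hnonneg : 0 ≤ √α * ∑ k, n k * t k :=
    mul_nonneg (Real.sqrt_nonneg α) (Finset.sum_nonneg fun k _ => mul_nonneg (hn k) (ht k))
  calc α * (∑ k, n k * t k) ^ 2 = (√α * ∑ k, n k * t k) ^ 2 := by rw [mul_pow, Real.sq_sqrt hα]
    _ ≤ (∑ k, √(n k) * √(q k) + √r * ∑ k, √(n k) * l k) ^ 2 := by gcongr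
    _ ≤ 2 * ((∑ k, √(n k) * √(q k)) ^ 2 + (√r * ∑ k, √(n k) * l k) ^ 2) := add_sq_le
    _ = 2 * (∑ k, √(n k) * √(q k)) ^ 2 + 2 * r * (∑ k, √(n k) * l k) ^ 2 := by
        rw [mul_pow, Real.sq_sqrt hr]
        ring
    _ ≤ _ := by gcongr

lemma sq_sum_sqrt_sampleSize_le (hK : 1 ≤ K) :
    (∑ k : Fin (K + 1), √(sampleSize nT nS k : ℝ)) ^ 2 ≤ 2 * K * totalSize K nT nS := by
  have hK1 : (1 : ℝ) ≤ K := by exact_mod_cast hK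
  calc (∑ k : Fin (K + 1), √(sampleSize nT nS k : ℝ)) ^ 2
      ≤ (K + 1) * ∑ k : Fin (K + 1), √(sampleSize nT nS k : ℝ) ^ 2 := by
        simpa using sq_sum_le_card_mul_sum_sq (s := Finset.univ)
          (f := fun k : Fin (K + 1) => √(sampleSize nT nS k : ℝ))
    _ = (K + 1) * totalSize K nT nS := by
        simp only [Real.sq_sqrt (Nat.cast_nonneg _), sum_sampleSize]
    _ ≤ 2 * K * totalSize K nT nS := by
        gcongr
        linarith

variable (u : Fin (K + 1) → EuclideanSpace ℝ (Fin p))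

lemma sum_sqrt_sampleSize_mul_l1Norm_le :
    ∑ k, √(sampleSize nT nS k : ℝ) * l1Norm (u k) ≤
      (∑ k : Fin (K + 1), √(sampleSize nT nS k : ℝ)) * l1Norm (u 0) + √nS * totalContrast u := by
  have hterm : ∀ k, l1Norm (u k) ≤ l1Norm (u 0) + l1Norm (u k - u 0) := fun k => by
    simpa using l1Norm_add_le (u 0) (u k - u 0)
  calc ∑ k, √(sampleSize nT nS k : ℝ) * l1Norm (u k)
      ≤ ∑ k, √(sampleSize nT nS k : ℝ) * (l1Norm (u 0) + l1Norm (u k - u 0)) := by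
        gcongr with k
        exact hterm k
    _ = (∑ k : Fin (K + 1), √(sampleSize nT nS k : ℝ)) * l1Norm (u 0) +
          ∑ k, √(sampleSize nT nS k : ℝ) * l1Norm (u k - u 0) := by
        simp only [mul_add, Finset.sum_add_distrib, Finset.sum_mul]
    _ = _ := by
        rw [Fin.sum_univ_succ (fun k => √(sampleSize nT nS k : ℝ) * l1Norm (u k - u 0)),
          totalContrast, Finset.mul_sum]
        simp [l1Norm, sampleSize]

lemma sq_sum_sqrt_sampleSize_mul_l1Norm_le (hK : 1 ≤ K) :
    (∑ k, √(sampleSize nT nS k : ℝ) * l1Norm (u k)) ^ 2 ≤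
      4 * K * totalSize K nT nS * l1Norm (u 0) ^ 2 + 2 * nS * totalContrast u ^ 2 := by
  have hnonneg : 0 ≤ ∑ k, √(sampleSize nT nS k : ℝ) * l1Norm (u k) :=
    Finset.sum_nonneg fun k _ => mul_nonneg (Real.sqrt_nonneg _) (l1Norm_nonneg _)
  set g := ∑ k : Fin (K + 1), √(sampleSize nT nS k : ℝ)
  calc (∑ k, √(sampleSize nT nS k : ℝ) * l1Norm (u k)) ^ 2
      ≤ (g * l1Norm (u 0) + √nS * totalContrast u) ^ 2 := by
        gcongr
        exact sum_sqrt_sampleSize_mul_l1Norm_le u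
    _ ≤ 2 * ((g * l1Norm (u 0)) ^ 2 + (√nS * totalContrast u) ^ 2) := add_sq_le
    _ = 2 * g ^ 2 * l1Norm (u 0) ^ 2 + 2 * nS * totalContrast u ^ 2 := by
        rw [mul_pow, mul_pow, Real.sq_sqrt (Nat.cast_nonneg _)]
        ring
    _ ≤ 2 * (2 * K * totalSize K nT nS) * l1Norm (u 0) ^ 2 + 2 * nS * totalContrast u ^ 2 := by
        gcongr
        exact sq_sum_sqrt_sampleSize_le hK
    _ = _ := by ring

lemma mul_norm_average_sq_le {α r : ℝ} (hα : 0 ≤ α) (hr : 0 ≤ r) (hK : 1 ≤ K)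
    (hN : (0 : ℝ) < totalSize K nT nS)
    {x : (k : Fin (K + 1)) → Fin (sampleSize nT nS k) → EuclideanSpace ℝ (Fin p)}
    (hx : ∀ k, RestrictedStronglyConvex α r (x k)) :
    α * ‖average nT nS u‖ ^ 2 ≤
      2 * predictionError x u + 8 * (K * (r / totalSize K nT nS)) * l1Norm (u 0) ^ 2 +
        4 * (r / totalSize K nT nS) * ((nS : ℝ) / totalSize K nT nS * totalContrast u ^ 2) := by
  have hcurv := mul_sum_mul_sq_le hα hr (fun k => Nat.cast_nonneg (sampleSize nT nS k))
    (fun k => norm_nonneg (u k))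
    (fun k => Finset.sum_nonneg fun (i : Fin (sampleSize nT nS k)) _ =>
      sq_nonneg (inner ℝ (x k i) (u k)))
    (fun k => l1Norm_nonneg (u k)) fun k => hx k (u k)
  rw [sum_sampleSize] at hcurv
  refine le_of_mul_le_mul_left ?_ (pow_pos hN 2)
  calc (totalSize K nT nS : ℝ) ^ 2 * (α * ‖average nT nS u‖ ^ 2)
      = α * (totalSize K nT nS * ‖average nT nS u‖) ^ 2 := by ring
    _ ≤ α * (∑ k, sampleSize nT nS k * ‖u k‖) ^ 2 := by
        gcongr
        exact totalSize_mul_norm_average_le u hN.ne'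
    _ ≤ _ := hcurv
    _ ≤ 2 * (totalSize K nT nS * ∑ k, ∑ i, inner ℝ (x k i) (u k) ^ 2) +
          2 * r *
            (4 * K * totalSize K nT nS * l1Norm (u 0) ^ 2 + 2 * nS * totalContrast u ^ 2) := by
        gcongr
        exact sq_sum_sqrt_sampleSize_mul_l1Norm_le u hK
    _ = _ := by
        rw [predictionError]
        field_simp
        ring

end AverageCurvature

section EstimationError

variable {lam : ℝ} {x : (k : Fin (K + 1)) → Fin (sampleSize nT nS k) → EuclideanSpace ℝ (Fin p)}
  {e : (k : Fin (K + 1)) → Fin (sampleSize nT nS k) → ℝ}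
  {β b : Fin (K + 1) → EuclideanSpace ℝ (Fin p)}

lemma cone_bounds {q lam on off d t u : ℝ} (hlam : 0 < lam) (hq : 0 ≤ q) (hoff : 0 ≤ off)
    (hd : 0 ≤ d) (hbasic : q ≤ lam * (3 * on - off + 32 * u - 15 * d)) (hon : on ≤ t + d) :
    q ≤ lam * (3 * t + 32 * u) ∧ on + off ≤ 4 * t + 32 * u ∧ d ≤ t / 4 + 8 / 3 * u := by
  have hcone : 0 ≤ 3 * on - off + 32 * u - 15 * d :=
    nonneg_of_mul_nonneg_right (hq.trans hbasic) hlam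
  refine ⟨hbasic.trans ?_, by linarith, by linarith⟩
  gcongr
  linarith

-- `257` and `16444` round up `8 * 2 * 4² + 4 * 2 / 4²` and `8 * 2 * 32² + 4 * 2 * (8 / 3)²`, which
-- come from `hl_le` and `hd_le`.
lemma sq_le_of_mul_sq_le {α lam s w u η q l d : ℝ} (hα : 0 < α) (hs : 0 ≤ s) (hη : 0 ≤ η)
    (hl : 0 ≤ l) (hd : 0 ≤ d) (hsmall : 1028 * (η * s) ≤ α)
    (hcurv : α * w ^ 2 ≤ 2 * q + 8 * η * l ^ 2 + 4 * η * d ^ 2)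
    (hq_le : q ≤ lam * (3 * (√s * w) + 32 * u)) (hl_le : l ≤ 4 * (√s * w) + 32 * u)
    (hd_le : d ≤ √s * w / 4 + 8 / 3 * u) :
    w ^ 2 ≤ 72 / α ^ 2 * (lam ^ 2 * s) + 128 / α * (lam * u) + 32888 / α * (η * u ^ 2) := by
  have hl_sq : l ^ 2 ≤ 2 * ((4 * (√s * w)) ^ 2 + (32 * u) ^ 2) :=
    (pow_le_pow_left₀ hl hl_le 2).trans add_sq_le
  have hd_sq : d ^ 2 ≤ 2 * ((√s * w / 4) ^ 2 + (8 / 3 * u) ^ 2) :=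
    (pow_le_pow_left₀ hd hd_le 2).trans add_sq_le
  have hyoung : 6 * (lam * (√s * w)) ≤ 36 / α * (lam ^ 2 * s) + α / 4 * w ^ 2 := by
    have hsquare : 0 ≤ (6 * lam * √s - α / 2 * w) ^ 2 / α := by positivity
    have hexpand : (6 * lam * √s - α / 2 * w) ^ 2 / α =
        36 / α * (lam ^ 2 * s) + α / 4 * w ^ 2 - 6 * (lam * (√s * w)) := by
      rw [sub_sq, mul_pow, mul_pow, Real.sq_sqrt hs]
      field_simp
      ring
    linarith
  have habsorb : 257 * (η * (√s * w) ^ 2) ≤ α / 4 * w ^ 2 := by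
    rw [mul_pow, Real.sq_sqrt hs]
    nlinarith [mul_le_mul_of_nonneg_right hsmall (sq_nonneg w)]
  have hhalf : α / 2 * w ^ 2 ≤
      36 / α * (lam ^ 2 * s) + 64 * (lam * u) + 16444 * (η * u ^ 2) := by
    have := mul_le_mul_of_nonneg_left hl_sq hη
    have := mul_le_mul_of_nonneg_left hd_sq hη
    have : 0 ≤ η * (√s * w) ^ 2 := by positivity
    have : 0 ≤ η * u ^ 2 := by positivity
    linarith
  calc w ^ 2 = 2 / α * (α / 2 * w ^ 2) := by field_simp
    _ ≤ 2 / α * (36 / α * (lam ^ 2 * s) + 64 * (lam * u) + 16444 * (η * u ^ 2)) := by gcongr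
    _ = _ := by
        field_simp
        ring

lemma mul_div_totalSize_le {r : ℝ} (hr : 0 ≤ r) (hnS : 0 < nS) :
    K * (r / totalSize K nT nS) ≤ r / nS := by
  have hKn : (K : ℝ) * nS ≤ totalSize K nT nS := by
    rw [totalSize]
    push_cast
    linarith [Nat.cast_nonneg (α := ℝ) nT]
  rcases (Nat.cast_nonneg (α := ℝ) (totalSize K nT nS)).eq_or_lt with hN | hN
  · rw [← hN, div_zero, mul_zero]
    positivity
  · rw [mul_div_assoc', div_le_div_iff₀ hN (by positivity)]
    nlinarith

lemma GoodEvent.norm_average_sub_sq_le {α r : ℝ}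
    (hG : GoodEvent α r lam (8 * √((nS : ℝ) / totalSize K nT nS)) x e) (hα : 0 < α) (hr : 0 ≤ r)
    (hlam : 0 < lam) (hK : 1 ≤ K) (hnS : 0 < nS) (hsmall : 1028 * (r * l0Norm (β 0)) ≤ α * nS)
    (hb : b ∈ argminSet lam (fun _ => 8 * √((nS : ℝ) / totalSize K nT nS)) x (response β x e)) :
    ‖average nT nS b - average nT nS β‖ ^ 2 ≤
      72 / α ^ 2 * (lam ^ 2 * l0Norm (β 0)) +
        128 / α * (lam * (√((nS : ℝ) / totalSize K nT nS) * totalContrast β)) +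
        32888 / α * (K * (r / totalSize K nT nS) *
          (√((nS : ℝ) / totalSize K nT nS) * totalContrast β) ^ 2) := by
  have hN : (0 : ℝ) < totalSize K nT nS := by
    exact_mod_cast Nat.add_pos_left (Nat.mul_pos hK hnS) nT
  have hfrac : (nS : ℝ) / totalSize K nT nS ≤ √((nS : ℝ) / totalSize K nT nS) := by
    refine Real.le_sqrt_of_sq_le (pow_le_of_le_one (by positivity) ?_ two_ne_zero)
    rw [div_le_one hN]
    exact_mod_cast (Nat.le_mul_of_pos_left nS hK).trans (Nat.le_add_right _ _)
  set τ := √((nS : ℝ) / totalSize K nT nS) with hτ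
  set T : Finset (Fin p) := {j | β 0 j ≠ 0} with hT
  have hcard : l0Norm (β 0) = T.card := by simp [l0Norm, hT, Set.ncard_eq_toFinset_card']
  rw [hcard] at hsmall ⊢
  have hd : 0 ≤ τ * totalContrast (b - β) :=
    mul_nonneg (Real.sqrt_nonneg _) (totalContrast_nonneg _)
  obtain ⟨hq_le, hl_le, hd_le⟩ := cone_bounds (t := √T.card * ‖average nT nS (b - β)‖)
    (u := τ * totalContrast β) hlam (predictionError_nonneg (x := x) (b - β))
    (Finset.sum_nonneg fun j (_ : j ∈ Tᶜ) => abs_nonneg ((b - β) 0 j)) hd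
    ((hG.predictionError_le (T := T) hlam.le (by positivity) hN (by simp [hT]) hb).trans_eq
      (by ring))
    ((sum_abs_le_norm_average (b - β) T hN.ne').trans <| by
      gcongr
      exact totalContrast_nonneg _)
  rw [Finset.sum_add_sum_compl] at hl_le
  rw [← average_sub]
  refine sq_le_of_mul_sq_le hα (Nat.cast_nonneg _) (by positivity)
    (l1Norm_nonneg ((b - β) 0)) hd ?_ ?_ hq_le hl_le hd_le
  · have := mul_div_totalSize_le (K := K) (nT := nT) hr hnS
    calc 1028 * (K * (r / totalSize K nT nS) * T.card) ≤ 1028 * (r / nS * T.card) := by gcongr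
      _ = 1028 * (r * T.card) / nS := by ring
      _ ≤ α := by rwa [div_le_iff₀ (by positivity)]
  · refine (mul_norm_average_sq_le (b - β) hα.le hr hK hN hG.curvature).trans ?_
    rw [mul_pow, hτ, Real.sq_sqrt (by positivity)]
    gcongr
    exact le_mul_of_one_le_left (by positivity) (by exact_mod_cast hK)

end EstimationError

end DeterministicAnalysis

section Minimizer

variable {K p nT nS : ℕ} {lam : ℝ} {a : Fin K → ℝ}
  {x : (k : Fin (K + 1)) → Fin (sampleSize nT nS k) → EuclideanSpace ℝ (Fin p)}
  {y : (k : Fin (K + 1)) → Fin (sampleSize nT nS k) → ℝ}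
  {b : Fin (K + 1) → EuclideanSpace ℝ (Fin p)}

@[fun_prop]
lemma continuous_l1Norm : Continuous (l1Norm (p := p)) := by
  unfold l1Norm
  fun_prop

lemma continuous_objective : Continuous (objective lam a x y) := by
  unfold objective
  fun_prop

lemma mul_penalty_le_objective :
    lam * (l1Norm (b 0) + ∑ k, a k * l1Norm (b k.succ - b 0)) ≤ objective lam a x y b :=
  le_add_of_nonneg_left (by positivity)

lemma norm_le_of_objective_le {c : ℝ} (hlam : 0 < lam) (ha : ∀ k, 0 < a k)
    (hb : objective lam a x y b ≤ c) (k : Fin (K + 1)) :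
    ‖b k‖ ≤ c / lam + ∑ k, c / lam / a k := by
  have hpenalty : l1Norm (b 0) + ∑ k, a k * l1Norm (b k.succ - b 0) ≤ c / lam := by
    rw [le_div_iff₀' hlam]
    exact mul_penalty_le_objective.trans hb
  have hterm : ∀ k, 0 ≤ a k * l1Norm (b k.succ - b 0) := fun k =>
    mul_nonneg (ha k).le (l1Norm_nonneg _)
  have htarget : ‖b 0‖ ≤ c / lam :=
    (norm_le_l1Norm _).trans ((le_add_of_nonneg_right (Finset.sum_nonneg fun k _ => hterm k)).trans
      hpenalty)
  have hnonneg : ∀ k, 0 ≤ c / lam / a k := fun k =>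
    div_nonneg ((norm_nonneg _).trans htarget) (ha k).le
  have hcontrast : ∀ k : Fin K, ‖b k.succ - b 0‖ ≤ ∑ k, c / lam / a k := fun k =>
    calc ‖b k.succ - b 0‖ ≤ l1Norm (b k.succ - b 0) := norm_le_l1Norm _
      _ ≤ c / lam / a k := by
        rw [le_div_iff₀' (ha k)]
        linarith [Finset.single_le_sum (fun k _ => hterm k) (Finset.mem_univ k),
          l1Norm_nonneg (b 0)]
      _ ≤ _ := Finset.single_le_sum (fun k _ => hnonneg k) (Finset.mem_univ k)
  cases k using Fin.cases with
  | zero => exact htarget.trans (le_add_of_nonneg_right (Finset.sum_nonneg fun k _ => hnonneg k))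
  | succ k =>
    calc ‖b k.succ‖ = ‖b 0 + (b k.succ - b 0)‖ := by rw [add_sub_cancel]
      _ ≤ ‖b 0‖ + ‖b k.succ - b 0‖ := norm_add_le _ _
      _ ≤ _ := add_le_add htarget (hcontrast k)

lemma argminSet_nonempty (hlam : 0 < lam) (ha : ∀ k, 0 < a k) : (argminSet lam a x y).Nonempty := by
  refine continuous_objective.exists_forall_le_of_isBounded 0 ?_
  exact isBounded_iff_forall_norm_le.2 ⟨_, fun b hb =>
    (pi_norm_le_iff_of_nonempty b).2 (norm_le_of_objective_le hlam ha hb)⟩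

end Minimizer

section Rate

variable {K p nT nS : ℕ}

lemma hBar_nonneg {h : Fin K → ℝ} (hh : 0 ≤ h) : 0 ≤ hBar nT nS h :=
  mul_nonneg (by positivity) (Finset.sum_nonneg fun k _ => hh k)

lemma rate_mono {s s' : ℕ} {h h' : Fin K → ℝ} (hs : s ≤ s') (hh : 0 ≤ h) (hle : h ≤ h') :
    rate p s nT nS h ≤ rate p s' nT nS h' := by
  have hbar_le : hBar nT nS h ≤ hBar nT nS h' := by
    unfold hBar
    gcongr with k
    exact hle k
  have hbar := hBar_nonneg (nT := nT) (nS := nS) hh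
  have hbar' := hbar.trans hbar_le
  have := Real.log_natCast_nonneg p
  unfold rate vn
  gcongr

lemma rate_nonneg {s : ℕ} {h : Fin K → ℝ} (hh : 0 ≤ h) : 0 ≤ rate p s nT nS h := by
  have hbar := hBar_nonneg (nT := nT) (nS := nS) hh
  have := Real.log_natCast_nonneg p
  unfold rate vn
  positivity

/-- The constant of the estimation error bound on a good event with curvature `α`, curvature loss
`ρ log p` and penalty level `c₀ √(log p / N)`. -/
noncomputable def errorConstant (α ρ c₀ : ℝ) : ℝ :=
  72 / α ^ 2 * c₀ ^ 2 + 128 / α * c₀ + 32888 / α * ρ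

lemma errorConstant_nonneg {α ρ c₀ : ℝ} (hα : 0 ≤ α) (hρ : 0 ≤ ρ) (hc₀ : 0 ≤ c₀) :
    0 ≤ errorConstant α ρ c₀ := by
  unfold errorConstant
  positivity

variable {α ρ c₀ : ℝ} {x : (k : Fin (K + 1)) → Fin (sampleSize nT nS k) → EuclideanSpace ℝ (Fin p)}
  {e : (k : Fin (K + 1)) → Fin (sampleSize nT nS k) → ℝ}
  {β b : Fin (K + 1) → EuclideanSpace ℝ (Fin p)}

lemma sqrt_mul_sqrt_mul_sum_eq (hnS : 0 < nS) (h : Fin K → ℝ) :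
    √(Real.log p / totalSize K nT nS) * (√((nS : ℝ) / totalSize K nT nS) * ∑ k, h k) =
      hBar nT nS h * √(Real.log p / nS) := by
  have := Real.log_natCast_nonneg p
  rw [← mul_assoc, ← Real.sqrt_mul (by positivity),
    show Real.log p / totalSize K nT nS * (nS / totalSize K nT nS) =
      ((nS : ℝ) / totalSize K nT nS) ^ 2 * (Real.log p / nS) by field_simp,
    Real.sqrt_mul (by positivity), Real.sqrt_sq (by positivity), hBar]
  ring

lemma mul_sq_sqrt_mul_sum_eq (hnS : 0 < nS) (h : Fin K → ℝ) :
    K * (Real.log p / totalSize K nT nS) * (√((nS : ℝ) / totalSize K nT nS) * ∑ k, h k) ^ 2 =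
      vn p nT nS h * hBar nT nS h * √(Real.log p / nS) := by
  have := Real.log_natCast_nonneg p
  have hsqrt : √((K : ℝ) ^ 2 * Real.log p / nS) = K * √(Real.log p / nS) := by
    rw [mul_div_assoc, Real.sqrt_mul (by positivity), Real.sqrt_sq (by positivity)]
  calc K * (Real.log p / totalSize K nT nS) * (√((nS : ℝ) / totalSize K nT nS) * ∑ k, h k) ^ 2
      = K * (Real.log p / nS) * hBar nT nS h ^ 2 := by
        rw [mul_pow, Real.sq_sqrt (by positivity), hBar]
        field_simp
    _ = vn p nT nS h * hBar nT nS h * √(Real.log p / nS) := by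
        rw [vn, hsqrt]
        linear_combination -(K * hBar nT nS h ^ 2) *
          Real.mul_self_sqrt (show 0 ≤ Real.log p / nS by positivity)

lemma error_terms_le_rate (hα : 0 ≤ α) (hρ : 0 ≤ ρ) (hc₀ : 0 ≤ c₀) (hnS : 0 < nS) {s : ℕ}
    {h : Fin K → ℝ} (hh : 0 ≤ h) :
    72 / α ^ 2 * ((c₀ * √(Real.log p / totalSize K nT nS)) ^ 2 * s) +
        128 / α * (c₀ * √(Real.log p / totalSize K nT nS) *
          (√((nS : ℝ) / totalSize K nT nS) * ∑ k, h k)) +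
        32888 / α * (K * (ρ * Real.log p / totalSize K nT nS) *
          (√((nS : ℝ) / totalSize K nT nS) * ∑ k, h k) ^ 2) ≤
      errorConstant α ρ c₀ * rate p s nT nS h := by
  have := Real.log_natCast_nonneg p
  have hbar := hBar_nonneg (nT := nT) (nS := nS) hh
  have hv : 0 ≤ vn p nT nS h := mul_nonneg (Real.sqrt_nonneg _) hbar
  calc _ = 72 / α ^ 2 * c₀ ^ 2 * (s * Real.log p / totalSize K nT nS) +
        128 / α * c₀ * (hBar nT nS h * √(Real.log p / nS)) +
        32888 / α * ρ * (vn p nT nS h * hBar nT nS h * √(Real.log p / nS)) := by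
        rw [mul_pow, Real.sq_sqrt (by positivity), ← sqrt_mul_sqrt_mul_sum_eq hnS,
          ← mul_sq_sqrt_mul_sum_eq hnS]
        ring
    _ ≤ errorConstant α ρ c₀ * (s * Real.log p / totalSize K nT nS) +
        errorConstant α ρ c₀ * (hBar nT nS h * √(Real.log p / nS)) +
        errorConstant α ρ c₀ * (vn p nT nS h * hBar nT nS h * √(Real.log p / nS)) := by
        have hsparse : 0 ≤ 72 / α ^ 2 * c₀ ^ 2 := by positivity
        have hlinear : 0 ≤ 128 / α * c₀ := by positivity
        have hquadratic : 0 ≤ 32888 / α * ρ := by positivity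
        unfold errorConstant
        gcongr <;> linarith
    _ = errorConstant α ρ c₀ * rate p s nT nS h := by
        rw [rate]
        ring

lemma norm_average_sub_target_sq_le {εD δ : ℝ} (hN : (totalSize K nT nS : ℝ) ≠ 0)
    (hεD : l1Norm (averageContrast nT nS β) ≤ εD)
    (hb : ‖average nT nS b - average nT nS β‖ ^ 2 ≤ δ) :
    ‖average nT nS b - β 0‖ ^ 2 ≤ 2 * (δ + εD ^ 2) := by
  have hbias : ‖average nT nS β - β 0‖ ≤ εD := by
    rw [average_eq_add_averageContrast β hN, add_sub_cancel_left]
    exact (norm_le_l1Norm _).trans hεD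
  calc ‖average nT nS b - β 0‖ ^ 2
      ≤ (‖average nT nS b - average nT nS β‖ + ‖average nT nS β - β 0‖) ^ 2 := by
        gcongr
        exact norm_sub_le_norm_sub_add_norm_sub _ _ _
    _ ≤ 2 * (‖average nT nS b - average nT nS β‖ ^ 2 + ‖average nT nS β - β 0‖ ^ 2) := add_sq_le
    _ ≤ 2 * (δ + εD ^ 2) := by gcongr

lemma GoodEvent.norm_average_sub_sq_le_rate {s : ℕ} {h : Fin K → ℝ}
    (hG : GoodEvent α (ρ * Real.log p) (c₀ * √(Real.log p / totalSize K nT nS))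
      (8 * √((nS : ℝ) / totalSize K nT nS)) x e)
    (hα : 0 < α) (hρ : 0 ≤ ρ) (hc₀ : 0 < c₀) (hK : 1 ≤ K) (hp : 2 ≤ p) (hnS : 0 < nS)
    (hsmall : 1028 * ρ / α * (s * Real.log p) ≤ nS) (hβ : β ∈ paramSpace s h)
    (hb : b ∈ argminSet (c₀ * √(Real.log p / totalSize K nT nS))
      (fun _ => 8 * √((nS : ℝ) / totalSize K nT nS)) x (response β x e)) :
    ‖average nT nS b - average nT nS β‖ ^ 2 ≤ errorConstant α ρ c₀ * rate p s nT nS h := by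
  have hL : 0 < Real.log p := Real.log_pos (by exact_mod_cast hp)
  have hN : (0 : ℝ) < totalSize K nT nS := by
    exact_mod_cast Nat.add_pos_left (Nat.mul_pos hK hnS) nT
  have hsparse : 1028 * (ρ * Real.log p * l0Norm (β 0)) ≤ α * nS := by
    have hs : (l0Norm (β 0) : ℝ) ≤ s := by exact_mod_cast hβ.1
    calc 1028 * (ρ * Real.log p * l0Norm (β 0)) ≤ 1028 * (ρ * Real.log p * s) := by gcongr
      _ = α * (1028 * ρ / α * (s * Real.log p)) := by field_simp
      _ ≤ α * nS := by gcongr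
  have hcontrast : 0 ≤ fun k : Fin K => l1Norm (β k.succ - β 0) := fun k => l1Norm_nonneg _
  calc ‖average nT nS b - average nT nS β‖ ^ 2
      ≤ errorConstant α ρ c₀ *
          rate p (l0Norm (β 0)) nT nS fun k => l1Norm (β k.succ - β 0) :=
        (hG.norm_average_sub_sq_le hα (by positivity) (by positivity) hK hnS hsparse hb).trans
          (error_terms_le_rate hα.le hρ hc₀.le hnS hcontrast)
    _ ≤ errorConstant α ρ c₀ * rate p s nT nS h :=
        mul_le_mul_of_nonneg_left (rate_mono hβ.1 hcontrast hβ.2)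
          (errorConstant_nonneg hα.le hρ hc₀.le)

lemma GoodEvent.argminSet_nonempty_and_error_bounds {s : ℕ} {h : Fin K → ℝ} {εD : ℝ}
    (hG : GoodEvent α (ρ * Real.log p) (c₀ * √(Real.log p / totalSize K nT nS))
      (8 * √((nS : ℝ) / totalSize K nT nS)) x e)
    (hα : 0 < α) (hρ : 0 ≤ ρ) (hc₀ : 0 < c₀) (hK : 1 ≤ K) (hp : 2 ≤ p) (hnS : 0 < nS)
    (hsmall : 1028 * ρ / α * (s * Real.log p) ≤ nS) (hβ : β ∈ paramSpace s h)
    (hεD : l1Norm (averageContrast nT nS β) ≤ εD) :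
    (argminSet (c₀ * √(Real.log p / totalSize K nT nS))
      (fun _ => 8 * √((nS : ℝ) / totalSize K nT nS)) x (response β x e)).Nonempty ∧
    ∀ b ∈ argminSet (c₀ * √(Real.log p / totalSize K nT nS))
        (fun _ => 8 * √((nS : ℝ) / totalSize K nT nS)) x (response β x e),
      ‖average nT nS b - average nT nS β‖ ^ 2 ≤
        (2 * errorConstant α ρ c₀ + 2) * rate p s nT nS h ∧
      ‖average nT nS b - β 0‖ ^ 2 ≤
        (2 * errorConstant α ρ c₀ + 2) * (rate p s nT nS h + εD ^ 2) := by
  have hL : 0 < Real.log p := Real.log_pos (by exact_mod_cast hp)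
  have hN : (0 : ℝ) < totalSize K nT nS := by
    exact_mod_cast Nat.add_pos_left (Nat.mul_pos hK hnS) nT
  have hC : 0 ≤ errorConstant α ρ c₀ := errorConstant_nonneg hα.le hρ hc₀.le
  have hrate : 0 ≤ rate p s nT nS h := rate_nonneg fun k => (l1Norm_nonneg _).trans (hβ.2 k)
  refine ⟨argminSet_nonempty (by positivity) fun _ => by positivity, fun b hb => ?_⟩
  have haverage := hG.norm_average_sub_sq_le_rate hα hρ hc₀ hK hp hnS hsmall hβ hb
  have htarget := norm_average_sub_target_sq_le hN.ne' hεD haverage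
  have hbias := mul_nonneg hC (sq_nonneg εD)
  have hvariance := mul_nonneg hC hrate
  constructor <;> linarith

end Rate

section GoodEventExistence

variable {Ω : Type u} [MeasurableSpace Ω] {μ : Measure Ω} {K p nT nS : ℕ} {α A : ℝ} {κ V : ℝ≥0}
  {X : (k : Fin (K + 1)) → Fin (sampleSize nT nS k) → Ω → EuclideanSpace ℝ (Fin p)}
  {ε : (k : Fin (K + 1)) → Fin (sampleSize nT nS k) → Ω → ℝ}

-- The union bound over the coordinates and the tasks costs `log K + 2 log p ≤ (A + 2) log p`;
-- the proxies are increased by `1` because the constants must be positive.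
lemma exists_measurableSet_goodEvent [IsProbabilityMeasure μ]
    (hX : ∀ k, SubGaussianSample μ α κ (X k)) (hε : SubGaussianErrors μ V X ε) (hα : 0 < α)
    (hK : 1 ≤ K) (hp : 2 ≤ p) (hKA : Real.log K ≤ A * Real.log p) (hnS : Real.log p ≤ nS) :
    ∃ E, MeasurableSet E ∧ 1 - 8 * Real.exp (-Real.log p) ≤ μ.real E ∧ ∀ ω ∈ E,
      GoodEvent (α / 4) (curvatureLoss α (κ + 1) (max A 0 + 2) * Real.log p)
        (noiseScale (κ + 1) (V + 1) (max A 0 + 2) * √(Real.log p / totalSize K nT nS))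
        (8 * √((nS : ℝ) / totalSize K nT nS)) (fun k i => X k i ω) fun k i => ε k i ω := by
  refine exists_measurableSet_of_measureReal_not_le
    (measureReal_not_goodEvent_le (fun k => (hX k).mono le_self_add) (hε.mono le_self_add) hα
      (by positivity) (by positivity) hK hp ?_ hnS)
  rw [add_mul]
  gcongr
  exact hKA.trans
    (mul_le_mul_of_nonneg_right (le_max_left A 0) (Real.log_natCast_nonneg p))

end GoodEventExistence

end TransFusion

theorem theorem1_general (α : ℝ) (hα : 0 < α) (κ V : ℝ≥0) (A : ℝ) :
    ∃ c₀ > (0 : ℝ), ∃ M > (0 : ℝ), ∃ C > (0 : ℝ),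
    ∀ (K nT nS p s : ℕ), 1 ≤ K → 1 ≤ s → Real.log K ≤ A * Real.log p →
      M * (s * Real.log p) ≤ nS →
    ∀ (h : Fin K → ℝ) (β : Fin (K + 1) → EuclideanSpace ℝ (Fin p)) (εD : ℝ),
      β ∈ TransFusion.paramSpace s h →
      TransFusion.l1Norm (TransFusion.averageContrast nT nS β) ≤ εD →
    ∀ (Ω : Type u) [MeasurableSpace Ω] (μ : Measure Ω) [IsProbabilityMeasure μ]
      (X : (k : Fin (K + 1)) → Fin (TransFusion.sampleSize nT nS k) → Ω →
        EuclideanSpace ℝ (Fin p))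
      (ε : (k : Fin (K + 1)) → Fin (TransFusion.sampleSize nT nS k) → Ω → ℝ),
      (∀ k, TransFusion.SubGaussianSample μ α κ (X k)) →
      TransFusion.SubGaussianErrors μ V X ε →
    ∃ E : Set Ω, MeasurableSet E ∧ 1 - 8 * Real.exp (-Real.log p) ≤ μ.real E ∧
      ∀ ω ∈ E,
        (TransFusion.argminSet
          (c₀ * √(Real.log p / (TransFusion.totalSize K nT nS : ℝ)))
          (fun _ => 8 * √((nS : ℝ) / (TransFusion.totalSize K nT nS : ℝ)))
          (fun k i => X k i ω)
          (TransFusion.response β (fun k i => X k i ω) (fun k i => ε k i ω))).Nonempty ∧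
        ∀ b ∈ TransFusion.argminSet
          (c₀ * √(Real.log p / (TransFusion.totalSize K nT nS : ℝ)))
          (fun _ => 8 * √((nS : ℝ) / (TransFusion.totalSize K nT nS : ℝ)))
          (fun k i => X k i ω)
          (TransFusion.response β (fun k i => X k i ω) (fun k i => ε k i ω)),
          ‖TransFusion.average nT nS b - TransFusion.average nT nS β‖ ^ 2
            ≤ C * TransFusion.rate p s nT nS h ∧
          ‖TransFusion.average nT nS b - β 0‖ ^ 2
            ≤ C * (TransFusion.rate p s nT nS h + εD ^ 2) := by
  set ρ := TransFusion.curvatureLoss α (κ + 1) (max A 0 + 2)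
  set c₀ := TransFusion.noiseScale (κ + 1) (V + 1) (max A 0 + 2)
  have hρ : 0 ≤ ρ := TransFusion.curvatureLoss_nonneg hα _ (by positivity)
  have hc₀ : 0 < c₀ := TransFusion.noiseScale_pos (by positivity) (by positivity) (by positivity)
  have hC : 0 ≤ TransFusion.errorConstant (α / 4) ρ c₀ :=
    TransFusion.errorConstant_nonneg (by positivity) hρ hc₀.le
  refine ⟨c₀, hc₀, 1028 * ρ / (α / 4) + 1, by positivity,
    2 * TransFusion.errorConstant (α / 4) ρ c₀ + 2, by positivity, ?_⟩
  intro K nT nS p s hK hs hKA hM h β εD hβ hεD Ω _ μ _ X ε hX hε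
  rcases lt_or_ge p 2 with hp | hp
  · refine ⟨∅, MeasurableSet.empty, ?_, fun ω hω => hω.elim⟩
    interval_cases p <;> norm_num
  have hL : 0 < Real.log p := Real.log_pos (by exact_mod_cast hp)
  have hsL : Real.log p ≤ s * Real.log p := le_mul_of_one_le_left hL.le (by exact_mod_cast hs)
  have hsmall : 0 ≤ 1028 * ρ / (α / 4) * (s * Real.log p) := by positivity
  have hnS : Real.log p ≤ nS := by linarith
  obtain ⟨E, hE, hprob, hgood⟩ :=
    TransFusion.exists_measurableSet_goodEvent hX hε hα hK hp hKA hnS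
  exact ⟨E, hE, hprob, fun ω hω =>
    (hgood ω hω).argminSet_nonempty_and_error_bounds (by positivity) hρ hc₀ hK hp
      (by exact_mod_cast hL.trans_le hnS) (by linarith) hβ hεD⟩

theorem theorem1 (cS : ℝ) (hcS : 0 < cS) (κ V : ℝ≥0) (A : ℝ) :
    ∃ c₀ > (0 : ℝ), ∃ M > (0 : ℝ), ∃ C > (0 : ℝ),
    ∃ c₁ > (0 : ℝ), ∃ c₂ > (0 : ℝ), ∃ c₃ > (0 : ℝ), ∃ c₄ > (0 : ℝ),
    ∀ (K nT nS p s : ℕ), 1 ≤ K → 1 ≤ s → Real.log K ≤ A * Real.log p →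
      M * (s * Real.log p) ≤ nS →
    ∀ (h : Fin K → ℝ) (β : Fin (K + 1) → EuclideanSpace ℝ (Fin p)) (εD : ℝ),
      β ∈ TransFusion.paramSpace s h →
      TransFusion.l1Norm (TransFusion.averageContrast nT nS β) ≤ εD →
    ∀ (Ω : Type u) [MeasurableSpace Ω] (μ : Measure Ω) [IsProbabilityMeasure μ]
      (S : Fin (K + 1) → Matrix (Fin p) (Fin p) ℝ)
      (X : (k : Fin (K + 1)) → Fin (TransFusion.sampleSize nT nS k) → Ω →
        EuclideanSpace ℝ (Fin p))
      (ε : (k : Fin (K + 1)) → Fin (TransFusion.sampleSize nT nS k) → Ω → ℝ),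
      TransFusion.SubGaussianDesigns μ cS κ S X →
      TransFusion.GaussianErrors μ V X ε →
    ∃ E : Set Ω, MeasurableSet E ∧
      1 - c₁ * Real.exp (-(c₂ * nT)) - c₃ * Real.exp (-(c₄ * Real.log p)) ≤ μ.real E ∧
      ∀ ω ∈ E,
        (TransFusion.argminSet
          (c₀ * √(Real.log p / (TransFusion.totalSize K nT nS : ℝ)))
          (fun _ => 8 * √((nS : ℝ) / (TransFusion.totalSize K nT nS : ℝ)))
          (fun k i => X k i ω)
          (TransFusion.response β (fun k i => X k i ω) (fun k i => ε k i ω))).Nonempty ∧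
        ∀ b ∈ TransFusion.argminSet
          (c₀ * √(Real.log p / (TransFusion.totalSize K nT nS : ℝ)))
          (fun _ => 8 * √((nS : ℝ) / (TransFusion.totalSize K nT nS : ℝ)))
          (fun k i => X k i ω)
          (TransFusion.response β (fun k i => X k i ω) (fun k i => ε k i ω)),
          ‖TransFusion.average nT nS b - TransFusion.average nT nS β‖ ^ 2
            ≤ C * TransFusion.rate p s nT nS h ∧
          ‖TransFusion.average nT nS b - β 0‖ ^ 2
            ≤ C * (TransFusion.rate p s nT nS h + εD ^ 2) := by
  obtain ⟨c₀, hc₀, M, hM, C, hC, hbound⟩ :=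
    theorem1_general (1 / cS) (one_div_pos.2 hcS) κ V A
  refine ⟨c₀, hc₀, M, hM, C, hC, 1, one_pos, 1, one_pos, 8, by norm_num, 1, one_pos, ?_⟩
  intro K nT nS p s hK hs hKA hnS h β εD hβ hεD Ω _ μ _ S X ε hX hε
  obtain ⟨E, hE, hprob, hgood⟩ := hbound K nT nS p s hK hs hKA hnS h β εD hβ hεD Ω μ X ε
    hX.subGaussianSample hε.subGaussianErrors
  refine ⟨E, hE, ?_, hgood⟩
  rw [one_mul, one_mul, one_mul]
  linarith [Real.exp_pos (-(nT : ℝ))]
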